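/- Let $\mathcal H$ be a separable complex Hilbert space and let $\mathcal P(\mathcal H)=\{P\in\mathcal B(\mathcal H): P=P^2=P^*\}$ be the set of orthogonal projections; $R(P)$ and $N(P)$ denote range and nullspace. Let $\Delta$ (resp. $\Gamma$) be the set of pairs $(P,Q)\in\mathcal P(\mathcal H)\times\mathcal P(\mathcal H)$ for which there exists (resp. does not exist) a closed subspace $\mathcal Z\subseteq\mathcal H$ with $R(P)\dotplus\mathcal Z=R(Q)\dotplus\mathcal Z=\mathcal H$ (direct sums). Fix an orthogonal decomposition $\mathcal H=\mathcal H_+\oplus\mathcal H_-$ into closed infinite-dimensional subspaces, and let $P_+$ be the orthogonal projection onto $\mathcal H_+$. Put $$Gr_{res}=\{P\in\mathcal P(\mathcal H): P-P_+ \text{ is compact}\},\qquad Gr_{res}^{(k)}=\{P\in Gr_{res}: \operatorname{index}(P_+,P)=k\}\quad (k\in\mathbb Z),$$ where $\operatorname{index}(P,Q)$ is the Fredholm index of $Q|_{R(P)}:R(P)\to R(Q)$ (an operator which is Fredholm when $P-Q$ is compact). A geodesic of $\mathcal P(\mathcal H)$ is a smooth curve $\delta:[0,1]\to\mathcal P(\mathcal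 H)$ with $\delta\,\ddot\delta\,(1-\delta)+(1-\delta)\,\ddot\delta\,\delta=0$ on $[0,1]$. A geodesic of $\mathcal P(\mathcal H)\times\mathcal P(\mathcal H)$ is a curve $\delta=(\delta_1,\delta_2)$ whose components are geodesics of $\mathcal P(\mathcal H)$; it is minimizing if its length $L(\delta)=\int_0^1(\|\dot\delta_1\|^2+\|\dot\delta_2\|^2)^{1/2}\,dt$ (operator norms) is at most that of every piecewise $C^1$ curve in $\mathcal P(\mathcal H)\times\mathcal P(\mathcal H)$ with the same endpoints. Then: (i) For every $k\in\mathbb Z$, $Gr_{res}^{(k)}\times Gr_{res}^{(k)}\subseteq\Delta$, and any two points of $Gr_{res}^{(k)}\times Gr_{res}^{(k)}$ can be joined by a minimizing geodesic of $\mathcal P(\mathcal H)\times\mathcal P(\mathcal H)$ contained in $\Delta$. (ii) For all $k\neq j$ in $\mathbb Z$, $Gr_{res}^{(k)}\times Gr_{res}^{(j)}\subseteq\Gamma$, and any two points of $Gr_{res}^{(k)}\times Gr_{res}^{(j)}$ can be joined by a minimizing geodesic of $\mathcal P(\mathcal H)\times\mathcal P(\mathcal H)$ contained in $\Gamma$.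 -/

import Mathlib

open Set
open scoped ContDiff

noncomputable section

namespace CommonComplement

variable {H : Type*} [NormedAddCommGroup H] [InnerProductSpace ℂ H] [CompleteSpace H]

/-- The set `P(H)` of orthogonal projections, `P = P² = P*`. -/
def projections (H : Type*) [NormedAddCommGroup H] [InnerProductSpace ℂ H] [CompleteSpace H] :
    Set (H →L[ℂ] H) :=
  {P | IsStarProjection P}

/-- Two subspaces have a common (closed) complement. -/
def HaveCommonComplement (S T : Submodule ℂ H) : Prop :=
  ∃ Z : Submodule ℂ H, IsClosed (Z : Set H) ∧ IsCompl S Z ∧ IsCompl T Z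

/-- Pairs of orthogonal projections whose ranges have a common complement. -/
def Delta (H : Type*) [NormedAddCommGroup H] [InnerProductSpace ℂ H] [CompleteSpace H] :
    Set ((H →L[ℂ] H) × (H →L[ℂ] H)) :=
  {p | p.1 ∈ projections H ∧ p.2 ∈ projections H ∧ HaveCommonComplement p.1.range p.2.range}

/-- Pairs of orthogonal projections whose ranges do not have a common complement. -/
def Gamma (H : Type*) [NormedAddCommGroup H] [InnerProductSpace ℂ H] [CompleteSpace H] :
    Set ((H →L[ℂ] H) × (H →L[ℂ] H)) :=
  {p | p.1 ∈ projections H ∧ p.2 ∈ projections H ∧ ¬ HaveCommonComplement p.1.range p.2.range}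

/-! ### The restricted Grassmannian -/

/-- The operator `Q|_{R(P)} : R(P) → R(Q)`. -/
def pairOperator (P Q : H →L[ℂ] H) : P.range →L[ℂ] Q.range :=
  Q.rangeRestrict ∘L P.range.subtypeL

/-- The index `dim ker T - dim coker T` of an operator (used for Fredholm operators, where both
dimensions are finite). -/
def fredholmIndex {E F : Type*} [NormedAddCommGroup E] [NormedSpace ℂ E]
    [NormedAddCommGroup F] [NormedSpace ℂ F] (T : E →L[ℂ] F) : ℤ :=
  (Module.finrank ℂ T.ker : ℤ) - (Module.finrank ℂ (F ⧸ T.range) : ℤ)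

/-- The index of a (Fredholm) pair of projections. -/
def pairIndex (P Q : H →L[ℂ] H) : ℤ := fredholmIndex (pairOperator P Q)

/-- The restricted Grassmannian relative to the projection `Pplus`. -/
def GrRes (Pplus : H →L[ℂ] H) : Set (H →L[ℂ] H) :=
  {P | P ∈ projections H ∧ IsCompactOperator (P - Pplus)}

/-- The part of index `k` of the restricted Grassmannian. Compactness of `P - Pplus` makes
`(Pplus, P)` a Fredholm pair, so the index is the genuine one. -/
def GrResComp (Pplus : H →L[ℂ] H) (k : ℤ) : Set (H →L[ℂ] H) :=
  {P | P ∈ GrRes Pplus ∧ pairIndex Pplus P = k}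

/-! ### Geodesics and length -/

/-- The idempotent of `B(H)` onto the tangent space of `P(H)` at `P`. -/
def tangentProj (P X : H →L[ℂ] H) : H →L[ℂ] H :=
  P * X * (1 - P) + (1 - P) * X * P

/-- The covariant derivative `DX/dt = E_γ(Ẋ)` of a field `X` along a curve `γ` on `[0, 1]`. -/
def covDeriv (γ X : ℝ → (H →L[ℂ] H)) (t : ℝ) : H →L[ℂ] H :=
  tangentProj (γ t) (derivWithin X (Icc 0 1) t)

/-- `δ : [0, 1] → P(H)` is a geodesic: a smooth curve in `P(H)` whose velocity is parallel. -/
def IsGeodesic (δ : ℝ → (H →L[ℂ] H)) : Prop :=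
  ContDiffOn ℝ ∞ δ (Icc 0 1) ∧ (∀ t ∈ Icc (0 : ℝ) 1, δ t ∈ projections H) ∧
    ∀ t ∈ Icc (0 : ℝ) 1, covDeriv δ (derivWithin δ (Icc 0 1)) t = 0

/-- Piecewise `C¹` curves on `[0, 1]`: `C¹` on each closed interval of a finite partition. -/
def IsPiecewiseC1 {E : Type*} [NormedAddCommGroup E] [NormedSpace ℝ E] (γ : ℝ → E) : Prop :=
  ∃ (n : ℕ) (s : Fin (n + 1) → ℝ), StrictMono s ∧ s 0 = 0 ∧ s (Fin.last n) = 1 ∧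
    ∀ i : Fin n, ContDiffOn ℝ 1 γ (Icc (s i.castSucc) (s i.succ))

/-- The length of a piecewise `C¹` curve in `P(H) × P(H)` for the product Finsler metric. -/
def curveLength (γ : ℝ → (H →L[ℂ] H) × (H →L[ℂ] H)) : ℝ :=
  ∫ t in (0 : ℝ)..1,
    Real.sqrt (‖deriv (fun s => (γ s).1) t‖ ^ 2 + ‖deriv (fun s => (γ s).2) t‖ ^ 2)

/-- `δ : [0, 1] → P(H) × P(H)` is a minimizing geodesic: a geodesic of the product, not longer
than any piecewise `C¹` curve in `P(H) × P(H)` with the same endpoints. -/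
def IsMinimizingGeodesic (δ : ℝ → (H →L[ℂ] H) × (H →L[ℂ] H)) : Prop :=
  IsGeodesic (fun t => (δ t).1) ∧ IsGeodesic (fun t => (δ t).2) ∧
    ∀ γ : ℝ → (H →L[ℂ] H) × (H →L[ℂ] H), IsPiecewiseC1 γ →
      (∀ t ∈ Icc (0 : ℝ) 1, γ t ∈ projections H ×ˢ projections H) →
      γ 0 = δ 0 → γ 1 = δ 1 → curveLength δ ≤ curveLength γ

/-- There is a minimizing geodesic of `P(H) × P(H)` from `a` to `b` contained in `A`. -/
def JoinedByMinimizingGeodesicIn (A : Set ((H →L[ℂ] H) × (H →L[ℂ] H)))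
    (a b : (H →L[ℂ] H) × (H →L[ℂ] H)) : Prop :=
  ∃ δ : ℝ → (H →L[ℂ] H) × (H →L[ℂ] H), IsMinimizingGeodesic δ ∧ δ 0 = a ∧ δ 1 = b ∧
    ∀ t ∈ Icc (0 : ℝ) 1, δ t ∈ A

end CommonComplement

end

open Set
open scoped ContDiff

noncomputable section

namespace CommonComplement

section

/-! ### Index of compact perturbations of the identity -/

section Algebra

variable {k V : Type*} [Field k] [AddCommGroup V] [Module k V]

/-! If `P` and `Q` both differ from `P_+` by a compact operator, then `P - Q` is compact and `(P,
Q)` is a Fredholm pair. Its index is the difference of the two component indices, because going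
round `P_+ → P → Q → P_+` is the identity plus a compact operator (`pairIndex_cocycle`). Everything
then rests on three implications for projections with compact difference.

Index zero gives a generator (`exists_generator`): a compact self-adjoint `Y` with `‖Y‖ ≤ π`,
anticommuting with `2P - 1`, such that `e^{iY}(2P - 1) = 2Q - 1`. Off the exceptional subspaces
`R(P) ∩ N(Q)` and `R(Q) ∩ N(P)`, `Y` is the argument of `(2Q - 1)(2P - 1)`. These two subspaces have
equal finite dimension, and there `Y` is `π` times an exchange of them.

A generator gives a common complement (`haveCommonComplement_geodesicOf`): the midpoint `M` of the
curve from `P` to `Q` is within `π/4 < 1` of both ends, so `N(M)` complements both ranges.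

A common complement gives index zero (`pairIndex_eq_zero_of_haveCommonComplement`): projecting along
it identifies `R(Q)` with `R(P)` and turns the pair operator into a compact perturbation of the
identity.

The second and third implications, applied between `P` and each later point, also show that the
geodesic stays in its component. For minimality, an extremal eigenvector of `Y` gives a unit vector
`x ∈ R(P)` with `⟨x, (2Q - 1)x⟩ = cos ‖Y‖`. Along any curve of projections the arccosine of this
quantity grows at rate at most twice the speed, so the length is at least `‖Y‖ / 2`, a bound on the
length of the geodesic (`norm_generator_le_length`). Cauchy–Schwarz combines the two factors
(`sqrt_le_curveLength`). -/

theorem ker_one_add_le_range (F : V →ₗ[k] V) : (1 + F).ker ≤ F.range := fun x hx => by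
  have h : x + F x = 0 := by simpa using hx
  exact ⟨-x, by rw [map_neg]; exact (eq_neg_of_add_eq_zero_left h).symm⟩

theorem finiteDimensional_ker_one_add (F : V →ₗ[k] V) [FiniteDimensional k F.range] :
    FiniteDimensional k (1 + F).ker :=
  Submodule.finiteDimensional_of_le (ker_one_add_le_range F)

/-- Every `v` is congruent to `-F v` modulo the range of `1 + F`, so the range of `F` fills the
cokernel. If `w = v + F v` with `w` in the range of `F`, then so is `v`; hence the only relations
come from `g`. -/
theorem exists_linearEquiv_coker_one_add (F : V →ₗ[k] V) (g : F.range →ₗ[k] F.range)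
    (hg : ∀ w, (g w : V) = w + F w) :
    Nonempty ((F.range ⧸ g.range) ≃ₗ[k] (V ⧸ (1 + F).range)) := by
  let f : F.range →ₗ[k] V ⧸ (1 + F).range := (1 + F).range.mkQ ∘ₗ F.range.subtype
  have hf : Function.Surjective f := fun y => by
    obtain ⟨v, rfl⟩ := Submodule.mkQ_surjective _ y
    refine ⟨⟨-F v, (F.range).neg_mem ⟨v, rfl⟩⟩, ?_⟩
    change Submodule.Quotient.mk _ = Submodule.Quotient.mk _
    rw [Submodule.Quotient.eq]
    exact ⟨-v, by simp; abel⟩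
  have hker : f.ker = g.range := by
    ext w
    simp only [f, LinearMap.ker_comp, Submodule.ker_mkQ, Submodule.mem_comap,
      Submodule.subtype_apply, LinearMap.mem_range]
    constructor
    · rintro ⟨v, hv⟩
      have hv' : v = w - F v := by rw [← hv]; simp
      exact ⟨⟨v, hv' ▸ F.range.sub_mem w.2 ⟨v, rfl⟩⟩, Subtype.ext (by rw [hg]; simpa using hv)⟩
    · rintro ⟨v, rfl⟩
      exact ⟨v, by simp [hg]⟩
  exact ⟨(Submodule.quotEquivOfEq _ _ hker.symm).trans (f.quotKerEquivOfSurjective hf)⟩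

theorem exists_restrict_one_add (F : V →ₗ[k] V) :
    ∃ g : F.range →ₗ[k] F.range, ∀ w, (g w : V) = w + F w :=
  ⟨(1 + F).restrict fun w hw => by
    simpa using F.range.add_mem hw ⟨w, rfl⟩, fun w => by simp⟩

theorem finiteDimensional_coker_one_add (F : V →ₗ[k] V) [FiniteDimensional k F.range] :
    FiniteDimensional k (V ⧸ (1 + F).range) := by
  obtain ⟨g, hg⟩ := exists_restrict_one_add F
  obtain ⟨e⟩ := exists_linearEquiv_coker_one_add F g hg
  exact e.finiteDimensional

/-- Kernel and cokernel are those of an endomorphism of the finite-dimensional space `F.range`,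
where rank–nullity applies. -/
theorem index_one_add (F : V →ₗ[k] V) [FiniteDimensional k F.range] : (1 + F).index = 0 := by
  obtain ⟨g, hg⟩ := exists_restrict_one_add F
  obtain ⟨e⟩ := exists_linearEquiv_coker_one_add F g hg
  have hker : (1 + F).ker = g.ker.map F.range.subtype := by
    ext x
    simp only [LinearMap.mem_ker, Submodule.mem_map, Submodule.subtype_apply]
    constructor
    · intro hx
      exact ⟨⟨x, ker_one_add_le_range F hx⟩, Subtype.ext (by rw [hg]; simpa using hx), rfl⟩
    · rintro ⟨y, hy, rfl⟩
      have := hg y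
      rw [hy] at this
      simpa using this.symm
  have h1 : Module.finrank k (1 + F).ker = Module.finrank k g.ker := by
    rw [hker]
    exact Submodule.finrank_map_subtype_eq F.range g.ker
  have h2 := LinearMap.index_eq_of_finiteDimensional (f := g)
  rw [LinearMap.index_eq_finrank_sub] at h2 ⊢
  rw [h1, ← e.finrank_eq]
  linarith

end Algebra

section Compact

variable {E : Type*} [NormedAddCommGroup E] [InnerProductSpace ℂ E]

theorem exists_finiteRank_norm_sub_le {K : E →L[ℂ] E} (hK : IsCompactOperator K)
    {ε : ℝ} (hε : 0 < ε) :
    ∃ F : E →L[ℂ] E, FiniteDimensional ℂ F.range ∧ ‖K - F‖ ≤ ε := by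
  have htb : TotallyBounded (K '' Metric.closedBall 0 1) :=
    (hK.isCompact_closure_image_closedBall (f := (K : E →ₗ[ℂ] E)) 1).totallyBounded.subset
      subset_closure
  obtain ⟨t, ht, hcov⟩ := Metric.totallyBounded_iff.1 htb ε hε
  -- `t` is a finite `ε`-net of the image of the unit ball; projecting onto its span moves no point
  -- of the image by more than `ε`.
  let W : Submodule ℂ E := Submodule.span ℂ t
  have : FiniteDimensional ℂ W := FiniteDimensional.span_of_finite ℂ ht
  refine ⟨W.starProjection ∘L K, ?_, ?_⟩
  · refine Submodule.finiteDimensional_of_le (S₂ := W) ?_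
    rintro _ ⟨x, rfl⟩
    exact Submodule.starProjection_apply_mem _ _
  · refine ContinuousLinearMap.opNorm_le_of_unit_norm hε.le fun x hx => ?_
    obtain ⟨y, hy, hxy⟩ := mem_iUnion₂.1 (hcov ⟨x, by simp [hx], rfl⟩)
    have hyW : y ∈ W := Submodule.subset_span hy
    have h1 : ‖K x - W.starProjection (K x)‖ ≤ ‖K x - y‖ := by
      rw [Submodule.starProjection_minimal]
      exact ciInf_le ⟨0, by rintro _ ⟨z, rfl⟩; positivity⟩ (⟨y, hyW⟩ : W)
    refine h1.trans ?_
    rw [← dist_eq_norm]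
    exact (Metric.mem_ball.1 hxy).le

variable [CompleteSpace E]

/-- With `F` of finite rank and `‖K - F‖ ≤ 1/2`, the operator `u = 1 + (K - F)` is invertible by the
Neumann series, and `1 + K = u (1 + u⁻¹ F)`. -/
theorem exists_factor_one_add_compact {K : E →L[ℂ] E} (hK : IsCompactOperator K) :
    ∃ (u : E ≃ₗ[ℂ] E) (F : E →ₗ[ℂ] E), FiniteDimensional ℂ F.range ∧
      ((1 + K : E →L[ℂ] E) : E →ₗ[ℂ] E) = u.toLinearMap ∘ₗ (1 + F) := by
  obtain ⟨F, hF, hKF⟩ := exists_finiteRank_norm_sub_le hK (ε := 1 / 2) (by norm_num)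
  have hu : ‖-(K - F)‖ < 1 := by rw [norm_neg]; linarith
  let u : (E →L[ℂ] E)ˣ := Units.oneSub _ hu
  have huv : (u : E →L[ℂ] E) = 1 + (K - F) := by simp [u]; abel
  let e : E ≃L[ℂ] E := ContinuousLinearEquiv.ofUnit u
  refine ⟨e.toLinearEquiv, e.symm.toLinearEquiv.toLinearMap ∘ₗ F, ?_, ?_⟩
  · have := hF
    rw [LinearMap.range_comp]
    infer_instance
  · ext x
    have h1 : e x = x + (K x - F x) := by
      change (u : E →L[ℂ] E) x = _
      rw [huv]; simp
    have h2 : e (e.symm (F x)) = F x := e.apply_symm_apply _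
    simp [h1]; abel

theorem fredholm_one_add_compact {K : E →L[ℂ] E} (hK : IsCompactOperator K) :
    FiniteDimensional ℂ (1 + K).ker ∧ FiniteDimensional ℂ (E ⧸ (1 + K).range) ∧
      fredholmIndex (1 + K) = 0 := by
  obtain ⟨u, F, hF, h⟩ := exists_factor_one_add_compact hK
  have := finiteDimensional_ker_one_add F
  have := finiteDimensional_coker_one_add F
  have : FiniteDimensional ℂ u.toLinearMap.ker := by
    rw [LinearEquiv.ker]; infer_instance
  have : FiniteDimensional ℂ (E ⧸ u.toLinearMap.range) := by
    rw [LinearEquiv.range]; infer_instance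
  refine ⟨?_, ?_, ?_⟩
  · rw [h, LinearMap.ker_comp_of_ker_eq_bot _ (LinearEquiv.ker u)]
    infer_instance
  · rw [h, LinearMap.range_comp]
    exact ((Submodule.Quotient.equiv (1 + F).range _ u rfl)).finiteDimensional
  · change LinearMap.index ((1 + K : E →L[ℂ] E) : E →ₗ[ℂ] E) = 0
    rw [h, LinearMap.index_comp, index_one_add, LinearEquiv.index_eq_zero, add_zero]

end Compact

end

section

/-! ### Fredholm pairs of projections -/

variable {H : Type*} [NormedAddCommGroup H] [InnerProductSpace ℂ H] [CompleteSpace H]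

theorem mem_range_iff_of_mem_projections {P : H →L[ℂ] H} (hP : P ∈ projections H) {x : H} :
    x ∈ P.range ↔ P x = x := by
  constructor
  · rintro ⟨y, rfl⟩
    exact congrArg (fun T : H →L[ℂ] H => T y) hP.isIdempotentElem.eq
  · exact fun h => ⟨x, h⟩

theorem apply_apply_of_mem_projections {P : H →L[ℂ] H} (hP : P ∈ projections H) (x : H) :
    P (P x) = P x :=
  congrArg (fun T : H →L[ℂ] H => T x) hP.isIdempotentElem.eq

theorem isClosed_range_of_mem_projections {P : H →L[ℂ] H} (hP : P ∈ projections H) :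
    IsClosed (P.range : Set H) := by
  have : (P.range : Set H) = {x | P x = x} := by
    ext x; exact mem_range_iff_of_mem_projections hP
  rw [this]
  exact isClosed_eq P.continuous continuous_id

theorem completeSpace_range_of_mem_projections {P : H →L[ℂ] H} (hP : P ∈ projections H) :
    CompleteSpace P.range :=
  (isClosed_range_of_mem_projections hP).completeSpace_coe

theorem IsCompactOperator.compressRange {A K : H →L[ℂ] H} (hK : IsCompactOperator K) :
    IsCompactOperator (A.rangeRestrict ∘L K ∘L A.range.subtypeL) :=
  (hK.comp_clm A.range.subtypeL).clm_comp A.rangeRestrict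

theorem exists_compact_pairOperator_comp {P Q : H →L[ℂ] H} (hP : P ∈ projections H)
    (h : IsCompactOperator (P - Q)) :
    ∃ K : P.range →L[ℂ] P.range, IsCompactOperator K ∧
      pairOperator Q P ∘L pairOperator P Q = 1 + K := by
  refine ⟨P.rangeRestrict ∘L (Q - P) ∘L P.range.subtypeL,
    IsCompactOperator.compressRange (by rw [← neg_sub]; exact h.neg), ?_⟩
  ext x
  have hx := (mem_range_iff_of_mem_projections hP).1 x.2
  change P (Q x) = x + P (Q x - P x)
  rw [hx, map_sub, hx]
  abel

/-- On `R(A)` the loop telescopes: `A C B = A + A ((C - A) B + (B - A))`. -/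
theorem exists_compact_pairOperator_comp_comp {A B C : H →L[ℂ] H} (hA : A ∈ projections H)
    (hAB : IsCompactOperator (A - B)) (hAC : IsCompactOperator (A - C)) :
    ∃ K : A.range →L[ℂ] A.range, IsCompactOperator K ∧
      pairOperator C A ∘L pairOperator B C ∘L pairOperator A B = 1 + K := by
  refine ⟨A.rangeRestrict ∘L ((C - A) ∘L B + (B - A)) ∘L A.range.subtypeL,
    IsCompactOperator.compressRange ?_, ?_⟩
  · refine IsCompactOperator.add ?_ ?_
    · refine IsCompactOperator.comp_clm (f := (C - A : H →L[ℂ] H)) ?_ B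
      rw [← neg_sub]; exact hAC.neg
    · rw [← neg_sub]; exact hAB.neg
  ext x
  have hx := (mem_range_iff_of_mem_projections hA).1 x.2
  change A (C (B x)) = x + A (C (B x) - A (B x) + (B x - A x))
  rw [hx, map_add, map_sub, map_sub, apply_apply_of_mem_projections hA, hx]
  abel

theorem isCompactOperator_sub_comm {A B : H →L[ℂ] H} (h : IsCompactOperator (A - B)) :
    IsCompactOperator (B - A) := by
  rw [← neg_sub]; exact h.neg

theorem finiteDimensional_ker_pairOperator {P Q : H →L[ℂ] H} (hP : P ∈ projections H)
    (h : IsCompactOperator (P - Q)) : FiniteDimensional ℂ (pairOperator P Q).ker := by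
  have := completeSpace_range_of_mem_projections hP
  obtain ⟨K, hK, e⟩ := exists_compact_pairOperator_comp hP h
  have := (fredholm_one_add_compact hK).1
  rw [← e] at this
  have : FiniteDimensional ℂ
      ((pairOperator Q P).toLinearMap ∘ₗ (pairOperator P Q).toLinearMap).ker := this
  exact Submodule.finiteDimensional_of_le (LinearMap.ker_le_ker_comp
    (pairOperator P Q).toLinearMap (pairOperator Q P).toLinearMap)

theorem finiteDimensional_coker_pairOperator {P Q : H →L[ℂ] H} (hQ : Q ∈ projections H)
    (h : IsCompactOperator (P - Q)) :
    FiniteDimensional ℂ (Q.range ⧸ (pairOperator P Q).range) := by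
  have := completeSpace_range_of_mem_projections hQ
  obtain ⟨K, hK, e⟩ := exists_compact_pairOperator_comp hQ (isCompactOperator_sub_comm h)
  have := (fredholm_one_add_compact hK).2.1
  rw [← e] at this
  have : FiniteDimensional ℂ
      (Q.range ⧸ ((pairOperator P Q).toLinearMap ∘ₗ (pairOperator Q P).toLinearMap).range) := this
  exact Module.Finite.of_surjective
    (Submodule.factor (LinearMap.range_comp_le_range (pairOperator Q P).toLinearMap
      (pairOperator P Q).toLinearMap))
    (Submodule.factor_surjective _)

theorem pairIndex_add_pairIndex_swap {P Q : H →L[ℂ] H} (hP : P ∈ projections H)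
    (hQ : Q ∈ projections H) (h : IsCompactOperator (P - Q)) :
    pairIndex P Q + pairIndex Q P = 0 := by
  have := completeSpace_range_of_mem_projections hP
  have h' := isCompactOperator_sub_comm h
  have := finiteDimensional_ker_pairOperator hP h
  have := finiteDimensional_ker_pairOperator hQ h'
  have := finiteDimensional_coker_pairOperator hQ h
  have := finiteDimensional_coker_pairOperator hP h'
  obtain ⟨K, hK, e⟩ := exists_compact_pairOperator_comp hP h
  have h0 := (fredholm_one_add_compact hK).2.2
  rw [← e] at h0
  have h1 := LinearMap.index_comp (f := (pairOperator P Q).toLinearMap)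
    (pairOperator Q P).toLinearMap
  have h2 : LinearMap.index ((pairOperator Q P).toLinearMap ∘ₗ (pairOperator P Q).toLinearMap) = 0 :=
    h0
  rw [h2] at h1
  rw [add_comm]
  exact h1.symm

theorem pairIndex_cocycle {A B C : H →L[ℂ] H} (hA : A ∈ projections H)
    (hB : B ∈ projections H) (hC : C ∈ projections H) (hAB : IsCompactOperator (A - B))
    (hAC : IsCompactOperator (A - C)) :
    pairIndex A C = pairIndex A B + pairIndex B C := by
  have := completeSpace_range_of_mem_projections hA
  have hBC : IsCompactOperator (B - C) := by
    have := hAC.sub hAB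
    rwa [← FunLike.coe_sub, sub_sub_sub_cancel_left] at this
  have hCA := isCompactOperator_sub_comm hAC
  have := finiteDimensional_ker_pairOperator hA hAB
  have := finiteDimensional_ker_pairOperator hB hBC
  have := finiteDimensional_ker_pairOperator hC hCA
  have := finiteDimensional_coker_pairOperator hB hAB
  have := finiteDimensional_coker_pairOperator hC hBC
  have := finiteDimensional_coker_pairOperator hA hCA
  obtain ⟨K, hK, e⟩ := exists_compact_pairOperator_comp_comp hA hAB hAC
  have h0 := (fredholm_one_add_compact hK).2.2
  rw [← e] at h0
  have h1 := LinearMap.index_comp (f := (pairOperator A B).toLinearMap)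
    (pairOperator B C).toLinearMap
  have : FiniteDimensional ℂ ((pairOperator B C).toLinearMap ∘ₗ (pairOperator A B).toLinearMap).ker := by
    rw [LinearMap.ker_comp]; infer_instance
  have : FiniteDimensional ℂ
      (C.range ⧸ ((pairOperator B C).toLinearMap ∘ₗ (pairOperator A B).toLinearMap).range) := by
    rw [LinearMap.range_comp]; infer_instance
  have h2 := LinearMap.index_comp
    (f := (pairOperator B C).toLinearMap ∘ₗ (pairOperator A B).toLinearMap)
    (pairOperator C A).toLinearMap
  have h3 : LinearMap.index ((pairOperator C A).toLinearMap ∘ₗ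
    (pairOperator B C).toLinearMap ∘ₗ (pairOperator A B).toLinearMap) = 0 := h0
  rw [h3, h1] at h2
  have h4 := pairIndex_add_pairIndex_swap hA hC hAC
  have h5 : pairIndex C A + (pairIndex B C + pairIndex A B) = 0 := h2.symm
  linarith

theorem inner_apply_of_mem_projections {P : H →L[ℂ] H} (hP : P ∈ projections H) (x y : H) :
    inner ℂ (P x) y = inner ℂ x (P y) := by
  have h := hP.isSelfAdjoint.adjoint_eq
  nth_rewrite 1 [← h]
  exact ContinuousLinearMap.adjoint_inner_left P y x

/-- Elements of `R(Q) ∩ N(P)` are orthogonal to `Q (R(P))`. -/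
theorem finrank_ker_swap_le_finrank_coker {P Q : H →L[ℂ] H} (hP : P ∈ projections H)
    (hQ : Q ∈ projections H) (h : IsCompactOperator (P - Q)) :
    Module.finrank ℂ (pairOperator Q P).ker ≤
      Module.finrank ℂ (Q.range ⧸ (pairOperator P Q).range) := by
  have := finiteDimensional_coker_pairOperator hQ h
  refine LinearMap.finrank_le_finrank_of_injective
    (f := (pairOperator P Q).range.mkQ ∘ₗ (pairOperator Q P).ker.subtype) ?_
  rw [← LinearMap.ker_eq_bot, LinearMap.ker_eq_bot']
  rintro ⟨⟨x, hxQ⟩, hx⟩ h0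
  have hPx : P x = 0 := congrArg Subtype.val hx
  have h1 : (⟨x, hxQ⟩ : Q.range) ∈ (pairOperator P Q).range := by
    simpa using h0
  obtain ⟨⟨y, hy⟩, hyx⟩ := h1
  have hQy : Q y = x := congrArg Subtype.val hyx
  have hxx : inner ℂ x x = 0 := by
    nth_rewrite 2 [← hQy]
    rw [← inner_apply_of_mem_projections hQ, (mem_range_iff_of_mem_projections hQ).1 hxQ,
      ← (mem_range_iff_of_mem_projections hP).1 hy, ← inner_apply_of_mem_projections hP, hPx,
      inner_zero_left]
  exact Subtype.ext (Subtype.ext (inner_self_eq_zero.1 hxx))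

/-- Each cokernel is at least as large as the kernel of the opposite operator. Since the two indices
add up to zero, both inequalities must be equalities. -/
theorem pairIndex_eq_finrank_ker_sub {P Q : H →L[ℂ] H} (hP : P ∈ projections H)
    (hQ : Q ∈ projections H) (h : IsCompactOperator (P - Q)) :
    pairIndex P Q = (Module.finrank ℂ (pairOperator P Q).ker : ℤ) -
      Module.finrank ℂ (pairOperator Q P).ker := by
  have h1 := finrank_ker_swap_le_finrank_coker hP hQ h
  have h2 := finrank_ker_swap_le_finrank_coker hQ hP (isCompactOperator_sub_comm h)
  have h3 := pairIndex_add_pairIndex_swap hP hQ h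
  simp only [pairIndex, fredholmIndex] at h3 ⊢
  lia

/-! ### Common complements -/

theorem pairIndex_eq_zero_of_haveCommonComplement {P Q : H →L[ℂ] H} (hP : P ∈ projections H)
    (hQ : Q ∈ projections H) (h : IsCompactOperator (P - Q))
    (hc : HaveCommonComplement P.range Q.range) : pairIndex P Q = 0 := by
  obtain ⟨Z, hZ, hPZ, hQZ⟩ := hc
  have := completeSpace_range_of_mem_projections hQ
  have hPcl := isClosed_range_of_mem_projections hP
  let p : H →L[ℂ] P.range := P.range.linearProjOfClosedCompl Z hPZ hPcl hZ
  have hp (x : P.range) : p x = x := Submodule.projectionOnto_apply_left hPZ x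
  have hp0 (x : H) : p x = 0 ↔ x ∈ Z := Submodule.projectionOnto_apply_eq_zero_iff hPZ
  have hpZ (x : H) : x - p x ∈ Z := by
    rw [← hp0, map_sub, hp, sub_self]
  let f : Q.range →ₗ[ℂ] P.range := p.toLinearMap ∘ₗ Q.range.subtype
  have hf : Function.Bijective f := by
    constructor
    · rw [← LinearMap.ker_eq_bot, LinearMap.ker_eq_bot']
      intro x hx
      have hxZ : (x : H) ∈ Z := (hp0 x).1 hx
      have := hQZ.disjoint.le_bot (⟨x.2, hxZ⟩ : (x : H) ∈ Q.range ⊓ Z)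
      exact Subtype.ext ((Submodule.mem_bot ℂ).1 this)
    · intro y
      obtain ⟨q, hq, z, hz, hqz⟩ := Submodule.mem_sup.1
        (hQZ.sup_eq_top.symm ▸ Submodule.mem_top : (y : H) ∈ Q.range ⊔ Z)
      refine ⟨⟨q, hq⟩, ?_⟩
      change p q = y
      rw [← hp y, ← hqz, map_add, (hp0 z).2 hz, add_zero]
  let e : Q.range ≃ₗ[ℂ] P.range := LinearEquiv.ofBijective f hf
  -- `r` vanishes on `R(P)`, so for `x ∈ R(Q)` one has `r x = r (Q - P) x`. This is what makes the
  -- error term compact.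
  let r : H →L[ℂ] H := P.range.subtypeL ∘L p - 1
  let K : Q.range →L[ℂ] Q.range := Q.rangeRestrict ∘L (r ∘L (Q - P)) ∘L Q.range.subtypeL
  have hK : IsCompactOperator K := by
    refine IsCompactOperator.compressRange ?_
    exact (isCompactOperator_sub_comm h).clm_comp r
  have hcomp : (pairOperator P Q).toLinearMap ∘ₗ e.toLinearMap = ((1 + K : Q.range →L[ℂ] Q.range)
      : Q.range →ₗ[ℂ] Q.range) := by
    ext x
    have hx := (mem_range_iff_of_mem_projections hQ).1 x.2
    have hpP : (p (P x) : H) = P x := congrArg Subtype.val (hp ⟨P x, ⟨x, rfl⟩⟩)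
    change Q (p x : H) = x + Q ((p (Q x - P x) : H) - (Q x - P x))
    rw [map_sub p, hx, Submodule.coe_sub, hpP, map_sub Q, map_sub Q, map_sub Q, hx]
    abel
  obtain ⟨-, -, h0⟩ := fredholm_one_add_compact hK
  have h1 : LinearMap.index ((pairOperator P Q).toLinearMap ∘ₗ e.toLinearMap) = 0 := by
    rw [hcomp]; exact h0
  have := finiteDimensional_ker_pairOperator hP h
  have := finiteDimensional_coker_pairOperator hQ h
  have : FiniteDimensional ℂ e.toLinearMap.ker := by
    rw [LinearEquiv.ker]; infer_instance
  have : FiniteDimensional ℂ (P.range ⧸ e.toLinearMap.range) := by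
    rw [LinearEquiv.range]; infer_instance
  rw [LinearMap.index_comp, LinearEquiv.index_eq_zero, add_zero] at h1
  exact h1

/-- A vector of `R(P) ∩ N(M)` is fixed by the strict contraction `P - M`. For spanning, solve `z -
(M - P) z = y` by inverting `1 - (M - P)`; then `y - P z = z - M z` lies in `N(M)`. -/
theorem isCompl_range_ker_of_norm_sub_lt_one {P M : H →L[ℂ] H} (hP : P ∈ projections H)
    (hM : M ∈ projections H) (h : ‖P - M‖ < 1) : IsCompl P.range M.ker := by
  constructor
  · rw [Submodule.disjoint_def]
    intro x hx hxM
    have hx' := (mem_range_iff_of_mem_projections hP).1 hx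
    have hxM' : M x = 0 := hxM
    have h1 : (P - M) x = x := by simp [hx', hxM']
    have h2 := (P - M).le_opNorm x
    rw [h1] at h2
    by_contra hne
    have := norm_pos_iff.2 hne
    nlinarith
  · rw [codisjoint_iff, eq_top_iff]
    intro y _
    have hu : ‖M - P‖ < 1 := by rwa [norm_sub_rev]
    let u : (H →L[ℂ] H)ˣ := Units.oneSub _ hu
    let z : H := (↑u⁻¹ : H →L[ℂ] H) y
    have hz : z - (M z - P z) = y := by
      have : (u : H →L[ℂ] H) ((↑u⁻¹ : H →L[ℂ] H) y) = y := by
        rw [← mul_apply_eq_comp, Units.mul_inv, one_apply_eq_self]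
      simpa [u, z] using this
    refine Submodule.mem_sup.2 ⟨P z, ⟨z, rfl⟩, y - P z, ?_, by abel⟩
    change M (y - P z) = 0
    rw [← hz]
    simp [apply_apply_of_mem_projections hM]

theorem haveCommonComplement_of_norm_sub_lt_one {P Q M : H →L[ℂ] H} (hP : P ∈ projections H)
    (hQ : Q ∈ projections H) (hM : M ∈ projections H) (hPM : ‖P - M‖ < 1) (hQM : ‖Q - M‖ < 1) :
    HaveCommonComplement P.range Q.range :=
  ⟨M.ker, M.isClosed_ker, isCompl_range_ker_of_norm_sub_lt_one hP hM hPM,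
    isCompl_range_ker_of_norm_sub_lt_one hQ hM hQM⟩

end

section

/-! ### Exponentials and arguments in C⋆-algebras -/

section CStar

variable {A : Type*} [CStarAlgebra A]

theorem semiconjBy_exp {x a b : A} (h : x * a = b * x) :
    x * NormedSpace.exp a = NormedSpace.exp b * x := by
  let +nondep : NormedAlgebra ℚ A := .restrictScalars ℚ ℂ A
  exact SemiconjBy.exp_right (x := x) h

theorem exp_smul_one (c : ℂ) : NormedSpace.exp (c • (1 : A)) = Complex.exp c • (1 : A) := by
  rw [← Algebra.algebraMap_eq_smul_one, ← Algebra.algebraMap_eq_smul_one, Complex.exp_eq_exp_ℂ,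
    NormedSpace.algebraMap_exp_comm]

theorem exp_smul_of_isIdempotentElem {p : A} (hp : p * p = p) (c : ℂ) :
    NormedSpace.exp (c • p) = 1 - p + Complex.exp c • p := by
  have h1 : p * NormedSpace.exp (c • (1 : A)) = NormedSpace.exp (c • p) * p :=
    semiconjBy_exp (by simp [hp])
  have h2 : (1 - p) * NormedSpace.exp (0 : A) = NormedSpace.exp (c • p) * (1 - p) :=
    semiconjBy_exp (by simp [mul_sub, hp])
  rw [exp_smul_one, mul_smul_comm, mul_one] at h1
  rw [NormedSpace.exp_zero, mul_one, mul_sub, mul_one, ← h1] at h2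
  rw [h2]; abel

/-- `J = p - q` for idempotents `p`, `q` with `p q = q p = 0` and sum `e`, and `e^{iπ} = e^{-iπ} =
-1`. -/
theorem exp_I_pi_smul {J e : A} (hJ : J * J = e) (heJ : e * J = J) (hJe : J * e = J) :
    NormedSpace.exp ((Complex.I * Real.pi) • J) = 1 - e - e := by
  let +nondep : NormedAlgebra ℚ A := .restrictScalars ℚ ℂ A
  have he : e * e = e := by nth_rewrite 2 [← hJ]; rw [← mul_assoc, heJ, hJ]
  let p : A := (1 / 2 : ℂ) • (e + J)
  let q : A := (1 / 2 : ℂ) • (e - J)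
  have hp : p * p = p := by
    simp only [p, smul_mul_smul_comm, mul_add, add_mul, he, heJ, hJe, hJ]; module
  have hq : q * q = q := by
    simp only [q, smul_mul_smul_comm, mul_sub, sub_mul, he, heJ, hJe, hJ]; module
  have hpq : p * q = 0 := by
    simp only [p, q, smul_mul_smul_comm, mul_sub, add_mul, he, heJ, hJe, hJ]; module
  have hqp : q * p = 0 := by
    simp only [p, q, smul_mul_smul_comm, mul_add, sub_mul, he, heJ, hJe, hJ]; module
  have hsplit : (Complex.I * Real.pi) • J =
      (Complex.I * Real.pi) • p + (-(Complex.I * Real.pi)) • q := by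
    simp only [p, q]; module
  have hexp : Complex.exp (Complex.I * Real.pi) = -1 := by rw [mul_comm, Complex.exp_pi_mul_I]
  rw [hsplit, NormedSpace.exp_add_of_commute, exp_smul_of_isIdempotentElem hp,
    exp_smul_of_isIdempotentElem hq, Complex.exp_neg, hexp]
  · have h3 : (1 - p + (-1 : ℂ) • p) * (1 - q + (-1 : ℂ)⁻¹ • q) = 1 - (p + q) - (p + q) := by
      rw [inv_neg_one, neg_one_smul, neg_one_smul]
      simp only [mul_add, mul_sub, mul_neg, add_mul, sub_mul, neg_mul, hpq, mul_one, one_mul]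
      abel
    rw [h3]
    simp only [p, q]; module
  · change _ * _ = _ * _
    simp [hpq, hqp]

/-- This is `e^{iθ} - 1 = 2i e^{iθ/2} sin (θ/2)`. Writing the sine through `sinc` isolates the
factor `θ` and leaves a cofactor that does not vanish at `θ = 0`. -/
theorem sub_one_eq_arg_mul {z : ℂ} (hz : ‖z‖ = 1) :
    z - 1 = z.arg * (Complex.exp ((z.arg / 2 : ℝ) * Complex.I) * Complex.I *
      (Real.sinc (z.arg / 2) : ℝ)) := by
  have h1 : z = Complex.exp (z.arg * Complex.I) := by
    have := Complex.norm_mul_exp_arg_mul_I z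
    rw [hz] at this
    simpa using this.symm
  have h2 : (z.arg : ℝ) * Real.sinc (z.arg / 2) = 2 * Real.sin (z.arg / 2) := by
    rw [Real.sinc_apply]
    split_ifs with h
    · rw [h, Real.sin_zero]; linarith
    · have : z.arg ≠ 0 := fun h0 => h (by rw [h0, zero_div])
      field_simp
  have h3 : (z.arg : ℂ) * (Real.sinc (z.arg / 2) : ℝ) = 2 * Complex.sin ((z.arg / 2 : ℝ)) := by
    rw [← Complex.ofReal_sin]; exact_mod_cast h2
  set θ : ℂ := ((z.arg / 2 : ℝ) : ℂ) with hθ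
  have h4 : (z.arg : ℂ) * Complex.I = θ * Complex.I + θ * Complex.I := by
    rw [hθ]; push_cast; ring
  have h5 : Complex.exp (θ * Complex.I) * Complex.exp (-θ * Complex.I) = 1 := by
    rw [← Complex.exp_add]; simp
  calc z - 1 = Complex.exp (θ * Complex.I) * Complex.exp (θ * Complex.I) - 1 := by
        rw [← Complex.exp_add, ← h4, ← h1]
    _ = Complex.exp (θ * Complex.I) * Complex.I * (2 * Complex.sin θ) := by
        rw [Complex.sin]
        linear_combination h5 - (Complex.exp (θ * Complex.I) * (Complex.exp (-θ * Complex.I) -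
          Complex.exp (θ * Complex.I))) * Complex.I_mul_I
    _ = _ := by rw [← h3]; ring

/-- The argument of a unitary `u` without eigenvalue `-1` is divisible by `u - 1`. -/
theorem exists_argSelfAdjoint_eq_mul {u : unitary A} (hu : ‖(u - 1 : A)‖ < 2) :
    ∃ h : A, (Unitary.argSelfAdjoint u : A) = h * (u - 1) := by
  -- `g` extends `(z - 1) / arg z` continuously across `z = 1`. It has no zero on the spectrum,
  -- since `|θ/2| < π` there, so `1 / g` is available to the functional calculus.
  let g : ℂ → ℂ := fun z => Complex.exp ((z.arg / 2 : ℝ) * Complex.I) * Complex.I *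
      (Real.sinc (z.arg / 2) : ℝ)
  have hsp : spectrum ℂ (u : A) ⊆ Complex.slitPlane :=
    (Unitary.spectrum_subset_slitPlane_iff_norm_lt_two u.2).2 hu
  have harg : ContinuousOn (fun z : ℂ => z.arg) (spectrum ℂ (u : A)) :=
    Complex.continuousOn_arg.mono hsp
  have hg : ContinuousOn g (spectrum ℂ (u : A)) := by
    refine ContinuousOn.mul (ContinuousOn.mul ?_ continuousOn_const) ?_
    · exact Complex.continuous_exp.comp_continuousOn
        ((Complex.continuous_ofReal.comp_continuousOn (harg.div_const 2)).mul continuousOn_const)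
    · exact Complex.continuous_ofReal.comp_continuousOn
        (Real.continuous_sinc.comp_continuousOn (harg.div_const 2))
  have hg0 : ∀ z ∈ spectrum ℂ (u : A), g z ≠ 0 := by
    intro z hz
    refine mul_ne_zero (mul_ne_zero (Complex.exp_ne_zero _) Complex.I_ne_zero) ?_
    rw [Complex.ofReal_ne_zero, Real.sinc_apply]
    split_ifs with h
    · exact one_ne_zero
    · refine div_ne_zero ?_ h
      intro hs
      have h1 := Complex.neg_pi_lt_arg z
      have h2 := Complex.arg_le_pi z
      rw [Real.sin_eq_zero_iff_of_lt_of_lt (by linarith) (by linarith [Real.pi_pos])] at hs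
      exact h hs
  refine ⟨cfc (fun z => (g z)⁻¹) (u : A), ?_⟩
  have h1 : (u - 1 : A) = cfc (fun z : ℂ => z - 1) (u : A) := by
    rw [cfc_sub (fun z : ℂ => z) (fun _ => 1) (u : A), cfc_id' ℂ (u : A), cfc_const_one ℂ (u : A)]
  rw [h1, ← cfc_mul (fun z => (g z)⁻¹) _ _ (hg.inv₀ hg0) (by fun_prop), Unitary.argSelfAdjoint_coe]
  refine cfc_congr fun z hz => ?_
  have hz1 : ‖z‖ = 1 := spectrum.norm_eq_one_of_unitary u.2 hz
  change (z.arg : ℂ) = (g z)⁻¹ * (z - 1)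
  rw [sub_one_eq_arg_mul hz1]
  change (z.arg : ℂ) = (g z)⁻¹ * (z.arg * g z)
  field_simp [hg0 z hz]

theorem star_exp_I_smul {Y : A} (hY : IsSelfAdjoint Y) :
    star (NormedSpace.exp (Complex.I • Y)) = NormedSpace.exp (-(Complex.I • Y)) := by
  rw [NormedSpace.star_exp, star_smul, hY.star_eq]
  simp

/-- The argument of a product `T * S` of two symmetries anticommutes with `S`. -/
theorem argSelfAdjoint_anticommute {u : unitary A} (hu : ‖(u - 1 : A)‖ < 2) {S T : A}
    (hS : IsSelfAdjoint S) (hSS : S * S = 1) (hT : IsSelfAdjoint T)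
    (huST : (u : A) = T * S) :
    S * (Unitary.argSelfAdjoint u : A) = -((Unitary.argSelfAdjoint u : A) * S) := by
  set Y : selfAdjoint A := Unitary.argSelfAdjoint u with hYdef
  have hexp : NormedSpace.exp (Complex.I • (Y : A)) = T * S := by
    rw [← huST, ← selfAdjoint.expUnitary_coe, hYdef, expUnitary_argSelfAdjoint hu]
  have hYn : ‖Y‖ < Real.pi := by
    rw [hYdef, Unitary.norm_argSelfAdjoint hu, Real.arccos_lt_pi]
    nlinarith [norm_nonneg (u - 1 : A)]
  have hSn : ‖S‖ ≤ 1 := by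
    nontriviality A
    have := CStarRing.norm_star_mul_self (x := S)
    rw [hS.star_eq, hSS, norm_one] at this
    nlinarith [norm_nonneg S]
  -- `Z` is a second logarithm of `u`, since `S u* S = u`. It also has norm less than `π`, so
  -- uniqueness of the argument gives `Y = Z`.
  let Z : selfAdjoint A := ⟨-(S * Y * S), by
    change star (-(S * (Y : A) * S)) = -(S * Y * S)
    rw [star_neg, star_mul, star_mul, hS.star_eq, Y.2.star_eq, mul_assoc]⟩
  have hZn : ‖Z‖ < Real.pi := by
    refine lt_of_le_of_lt ?_ hYn
    change ‖-(S * (Y : A) * S)‖ ≤ ‖(Y : A)‖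
    rw [norm_neg]
    calc ‖S * (Y : A) * S‖ ≤ ‖S‖ * ‖(Y : A)‖ * ‖S‖ := norm_mul₃_le
      _ ≤ 1 * ‖(Y : A)‖ * 1 := by gcongr
      _ = _ := by ring
  have hZ : S * NormedSpace.exp (Complex.I • (Z : A)) =
      NormedSpace.exp (-(Complex.I • (Y : A))) * S := by
    refine semiconjBy_exp ?_
    change S * (Complex.I • -(S * (Y : A) * S)) = _
    rw [mul_smul_comm, mul_neg, ← mul_assoc, ← mul_assoc, hSS, one_mul, neg_mul, smul_neg,
      smul_mul_assoc]
  have hZu : selfAdjoint.expUnitary Z = u := by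
    ext
    rw [selfAdjoint.expUnitary_coe, huST]
    rw [← star_exp_I_smul Y.2, hexp, star_mul, hS.star_eq, hT.star_eq] at hZ
    calc NormedSpace.exp (Complex.I • (Z : A))
        = S * (S * NormedSpace.exp (Complex.I • (Z : A))) := by rw [← mul_assoc, hSS, one_mul]
      _ = T * S := by rw [hZ, ← mul_assoc, ← mul_assoc, hSS, one_mul]
  have hYZ : Y = Z := by
    rw [hYdef, ← hZu, argSelfAdjoint_expUnitary hZn]
  have : (Y : A) = -(S * Y * S) := congrArg Subtype.val hYZ
  calc S * (Y : A) = S * (-(S * Y * S)) := by rw [← this]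
    _ = _ := by rw [mul_neg, ← mul_assoc, ← mul_assoc, hSS, one_mul]

end CStar

end

section

/-! ### The generator of a geodesic -/

variable {H : Type*} [NormedAddCommGroup H] [InnerProductSpace ℂ H] [CompleteSpace H]

/-- For self-adjoint `Y` one of `±‖Y‖` is in the spectrum, and nonzero spectral values of a compact
operator are eigenvalues. -/
theorem exists_eigenvector_norm {Y : H →L[ℂ] H} (hY : IsSelfAdjoint Y)
    (hc : IsCompactOperator Y) (h0 : Y ≠ 0) :
    ∃ (v : H) (r : ℝ), v ≠ 0 ∧ |r| = ‖Y‖ ∧ Y v = (r : ℂ) • v := by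
  obtain ⟨r, hr, hsp⟩ : ∃ r : ℝ, |r| = ‖Y‖ ∧ r ∈ spectrum ℝ Y := by
    have : Nontrivial (H →L[ℂ] H) := ⟨Y, 0, h0⟩
    rcases CStarAlgebra.norm_or_neg_norm_mem_spectrum hY with h | h
    · exact ⟨_, abs_of_nonneg (norm_nonneg _), h⟩
    · exact ⟨_, by rw [abs_neg, abs_of_nonneg (norm_nonneg _)], h⟩
  have hr0 : (r : ℂ) ≠ 0 := by
    rw [Complex.ofReal_ne_zero]
    rintro rfl
    rw [abs_zero] at hr
    exact h0 (norm_eq_zero.1 hr.symm)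
  have hsp' : (r : ℂ) ∈ spectrum ℂ Y := by
    rw [← hY.spectrumRestricts.algebraMap_image]
    exact ⟨r, hsp, rfl⟩
  obtain ⟨v, hv⟩ := ((hc.hasEigenvalue_iff_mem_spectrum hr0).2 hsp').exists_hasEigenvector
  exact ⟨v, r, hv.2, hr, hv.apply_eq_smul⟩

/-- The symmetry `2P - 1` of a projection. -/
def symmetry (P : H →L[ℂ] H) : H →L[ℂ] H := P + P - 1

theorem symmetry_mul_self {P : H →L[ℂ] H} (hP : P ∈ projections H) :
    symmetry P * symmetry P = 1 := by
  have := hP.isIdempotentElem.eq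
  simp only [symmetry, mul_sub, mul_add, sub_mul, add_mul, this, mul_one, one_mul]
  abel

theorem isSelfAdjoint_symmetry {P : H →L[ℂ] H} (hP : P ∈ projections H) :
    IsSelfAdjoint (symmetry P) :=
  (hP.isSelfAdjoint.add hP.isSelfAdjoint).sub (.one _)

theorem mem_projections_of_symmetry {S : H →L[ℂ] H} (hS : IsSelfAdjoint S) (hSS : S * S = 1) :
    (1 / 2 : ℂ) • (1 + S) ∈ projections H := by
  constructor
  · change _ * _ = _
    simp only [smul_mul_smul_comm, mul_add, add_mul, mul_one, one_mul, hSS]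
    module
  · change star _ = _
    rw [star_smul, star_add, star_one, hS.star_eq]
    simp

theorem norm_le_one_of_mul_self_eq_one {S : H →L[ℂ] H} (hS : IsSelfAdjoint S) (hSS : S * S = 1) :
    ‖S‖ ≤ 1 := by
  have := CStarRing.norm_star_mul_self (x := S)
  rw [hS.star_eq, hSS] at this
  have h1 : ‖(1 : H →L[ℂ] H)‖ ≤ 1 := ContinuousLinearMap.norm_id_le
  nlinarith [norm_nonneg S]

theorem norm_sub_le_one_of_mem_projections {P Q : H →L[ℂ] H} (hP : P ∈ projections H)
    (hQ : Q ∈ projections H) : ‖P - Q‖ ≤ 1 := by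
  have hn (R : H →L[ℂ] H) (hR : R ∈ projections H) : ‖symmetry R‖ ≤ 1 :=
    norm_le_one_of_mul_self_eq_one (isSelfAdjoint_symmetry hR) (symmetry_mul_self hR)
  have h : P - Q = (1 / 2 : ℂ) • (symmetry P - symmetry Q) := by
    simp only [symmetry]; module
  rw [h, norm_smul]
  have := norm_sub_le (symmetry P) (symmetry Q)
  have := hn P hP
  have := hn Q hQ
  norm_num
  linarith

theorem norm_sq_apply_of_mem_projections {P : H →L[ℂ] H} (hP : P ∈ projections H) (x : H) :
    ‖x‖ ^ 2 = ‖P x‖ ^ 2 + ‖x - P x‖ ^ 2 := by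
  have h : inner ℂ (P x) (x - P x) = 0 := by
    rw [inner_apply_of_mem_projections hP, map_sub, apply_apply_of_mem_projections hP, sub_self,
      inner_zero_right]
  have := norm_add_sq_eq_norm_sq_add_norm_sq_of_inner_eq_zero _ _ h
  rw [add_sub_cancel] at this
  nlinarith

/-- If `R(P) ∩ N(Q) = N(P) ∩ R(Q) = 0` and `P - Q` is compact then `‖P - Q‖ < 1`. -/
theorem norm_sub_lt_one_of_compact {P Q : H →L[ℂ] H} (hP : P ∈ projections H)
    (hQ : Q ∈ projections H) (hc : IsCompactOperator (P - Q))
    (h1 : ∀ x, P x = x → Q x = 0 → x = 0) (h2 : ∀ x, Q x = x → P x = 0 → x = 0) :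
    ‖P - Q‖ < 1 := by
  refine lt_of_le_of_ne (norm_sub_le_one_of_mem_projections hP hQ) fun hn => ?_
  obtain ⟨v, r, hv, hr, hYv⟩ := exists_eigenvector_norm (hP.isSelfAdjoint.sub hQ.isSelfAdjoint) hc
    (by intro h0; rw [h0, norm_zero] at hn; exact zero_ne_one hn)
  rw [hn] at hr
  -- A difference of projections attains the eigenvalue `1` only on `R(P) ∩ N(Q)`: the relation `P v
  -- = v + Q v` makes `⟨P v, Q v⟩` equal both to `2‖Q v‖²` and to `0`.
  have key (P Q : H →L[ℂ] H) (hP : P ∈ projections H) (hQ : Q ∈ projections H)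
      (h : P v - Q v = v) : P v = v ∧ Q v = 0 := by
    have hQv : Q v = 0 := by
      have e1 : v - P v = -Q v := by nth_rewrite 1 [← h]; abel
      have e2 := norm_sq_apply_of_mem_projections hP v
      have e3 : inner ℂ (P v) (Q v) = inner ℂ (Q v) (Q v) + inner ℂ (Q v) (Q v) := by
        have a1 : P v = v + Q v := by nth_rewrite 2 [← h]; abel
        rw [a1, inner_add_left]
        congr 1
        rw [inner_apply_of_mem_projections hQ, apply_apply_of_mem_projections hQ]
      have e4 : inner ℂ (P v) (Q v) = 0 := by
        have a1 : Q v = P v - v := by nth_rewrite 3 [← h]; abel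
        rw [a1, inner_apply_of_mem_projections hP, map_sub, apply_apply_of_mem_projections hP,
          sub_self, inner_zero_right]
      rw [e4] at e3
      have : inner ℂ (Q v) (Q v) = 0 := by linear_combination -(1 / 2 : ℂ) * e3
      exact inner_self_eq_zero.1 this
    exact ⟨by simpa [hQv] using h, hQv⟩
  rcases abs_eq (zero_le_one' ℝ) |>.1 hr with rfl | rfl
  · obtain ⟨a, b⟩ := key P Q hP hQ (by simpa using hYv)
    exact hv (h1 v a b)
  · obtain ⟨a, b⟩ := key Q P hQ hP (by
      have h := congrArg Neg.neg hYv
      simpa using h)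
    exact hv (h2 v a b)

/-- For `u = (2Q - 1)(2P - 1)` one has `u - 1 = -2 (P - Q)(2P - 1)`, of norm below `2`, so `u` has a
continuous argument `Y`. Writing `Y = h (u - 1)` transfers compactness from `P - Q`, and shows that
`Y` kills whatever `u` fixes. -/
theorem exists_generator_of_norm_lt_one {P Q : H →L[ℂ] H} (hP : P ∈ projections H)
    (hQ : Q ∈ projections H) (hc : IsCompactOperator (P - Q)) (hn : ‖P - Q‖ < 1) :
    ∃ Y : H →L[ℂ] H, IsSelfAdjoint Y ∧ IsCompactOperator Y ∧
      symmetry P * Y = -(Y * symmetry P) ∧ ‖Y‖ ≤ Real.pi ∧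
      NormedSpace.exp (Complex.I • Y) = symmetry Q * symmetry P ∧
      ∀ e : H →L[ℂ] H, symmetry Q * symmetry P * e = e → Y * e = 0 := by
  have hS := isSelfAdjoint_symmetry hP
  have hT := isSelfAdjoint_symmetry hQ
  have hSS := symmetry_mul_self hP
  have hTT := symmetry_mul_self hQ
  let u : unitary (H →L[ℂ] H) := ⟨symmetry Q * symmetry P, by
    rw [Unitary.mem_iff, star_mul, hS.star_eq, hT.star_eq]
    constructor
    · rw [mul_assoc, ← mul_assoc (symmetry Q) (symmetry Q), hTT, one_mul, hSS]
    · rw [mul_assoc, ← mul_assoc (symmetry P) (symmetry P), hSS, one_mul, hTT]⟩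
  have hu1 : (u - 1 : H →L[ℂ] H) = -((P - Q) + (P - Q)) * symmetry P := by
    change symmetry Q * symmetry P - 1 = _
    rw [← hSS, ← sub_mul]
    congr 1
    simp only [symmetry]; abel
  have hSn : ‖symmetry P‖ ≤ 1 := norm_le_one_of_mul_self_eq_one hS hSS
  have hu : ‖(u - 1 : H →L[ℂ] H)‖ < 2 := by
    rw [hu1]
    refine (norm_mul_le _ _).trans_lt ?_
    rw [norm_neg]
    have := norm_add_le (P - Q) (P - Q)
    nlinarith [norm_nonneg (P - Q + (P - Q)), norm_nonneg (symmetry P)]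
  obtain ⟨h, hh⟩ := exists_argSelfAdjoint_eq_mul hu
  refine ⟨Unitary.argSelfAdjoint u, (Unitary.argSelfAdjoint u).2, ?_,
    argSelfAdjoint_anticommute hu hS hSS hT rfl, Unitary.norm_argSelfAdjoint_le_pi u, ?_, ?_⟩
  · rw [hh, hu1]
    exact ((hc.add hc).neg.comp_clm (symmetry P)).clm_comp h
  · rw [← selfAdjoint.expUnitary_coe, expUnitary_argSelfAdjoint hu]
  · intro e he
    rw [hh, mul_assoc, sub_mul, one_mul]
    change h * (symmetry Q * symmetry P * e - e) = 0
    rw [he, sub_self, mul_zero]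

end

/-! ### Generators for pairs of index zero -/

section

variable {H : Type*} [NormedAddCommGroup H] [InnerProductSpace ℂ H] [CompleteSpace H]

/-- Finite-dimensional subspaces of the same dimension are the initial and the final space of a
partial isometry. -/
theorem exists_partialIsometry (M N : Submodule ℂ H) [FiniteDimensional ℂ M]
    [FiniteDimensional ℂ N] (h : Module.finrank ℂ M = Module.finrank ℂ N) :
    ∃ W : H →L[ℂ] H, star W * W = M.starProjection ∧ W * star W = N.starProjection ∧
      N.starProjection * W = W ∧ W * M.starProjection = W := by
  let L : M ≃ₗᵢ[ℂ] N :=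
    ((stdOrthonormalBasis ℂ M).equiv (stdOrthonormalBasis ℂ N) (finCongr h))
  let W : H →L[ℂ] H := N.subtypeL ∘L (L : M →L[ℂ] N) ∘L M.orthogonalProjectionOnto
  let W' : H →L[ℂ] H := M.subtypeL ∘L (L.symm : N →L[ℂ] M) ∘L N.orthogonalProjectionOnto
  have hW (x : H) : W x = L (M.orthogonalProjectionOnto x) := rfl
  have hW' (x : H) : W' x = L.symm (N.orthogonalProjectionOnto x) := rfl
  have hstar : star W = W' := by
    rw [ContinuousLinearMap.star_eq_adjoint]
    symm
    rw [ContinuousLinearMap.eq_adjoint_iff]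
    intro x y
    rw [hW, hW', ← Submodule.inner_orthogonalProjectionOnto_eq_of_mem_left,
      ← Submodule.inner_orthogonalProjectionOnto_eq_of_mem_right,
      ← L.inner_map_map, L.apply_symm_apply]
  refine ⟨W, ?_, ?_, ?_, ?_⟩
  · rw [hstar]; ext x
    change W' (W x) = M.orthogonalProjectionOnto x
    rw [hW', hW, Submodule.orthogonalProjectionOnto_mem_subspace_eq_self, L.symm_apply_apply]
  · rw [hstar]; ext x
    change W (W' x) = N.orthogonalProjectionOnto x
    rw [hW', hW, Submodule.orthogonalProjectionOnto_mem_subspace_eq_self, L.apply_symm_apply]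
  · ext x
    change N.starProjection (W x) = W x
    rw [hW]
    exact Submodule.starProjection_eq_self_iff.2 (SetLike.coe_mem _)
  · ext x
    change W (M.starProjection x) = W x
    rw [hW, hW]
    congr 2
    exact Submodule.orthogonalProjectionOnto_mem_subspace_eq_self _

theorem finrank_ker_pairOperator {P Q : H →L[ℂ] H} :
    Module.finrank ℂ (pairOperator P Q).ker = Module.finrank ℂ (P.range ⊓ Q.ker : Submodule ℂ H) := by
  have h : (P.range ⊓ Q.ker : Submodule ℂ H) = (pairOperator P Q).ker.map P.range.subtype := by
    ext x
    simp only [Submodule.mem_inf, Submodule.mem_map]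
    constructor
    · exact fun ⟨hx, hx'⟩ => ⟨⟨x, hx⟩, Subtype.ext hx', rfl⟩
    · rintro ⟨y, hy, rfl⟩
      exact ⟨y.2, congrArg Subtype.val hy⟩
  rw [h]
  exact (Submodule.finrank_map_subtype_eq _ _).symm

theorem finiteDimensional_range_inf_ker {P Q : H →L[ℂ] H} (hP : P ∈ projections H)
    (h : IsCompactOperator (P - Q)) :
    FiniteDimensional ℂ (P.range ⊓ Q.ker : Submodule ℂ H) := by
  have := finiteDimensional_ker_pairOperator hP h
  have h : (P.range ⊓ Q.ker : Submodule ℂ H) ≤ (pairOperator P Q).ker.map P.range.subtype :=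
    fun x ⟨hx, hx'⟩ => ⟨⟨x, hx⟩, Subtype.ext hx', rfl⟩
  exact Submodule.finiteDimensional_of_le h

theorem isCompactOperator_starProjection (M : Submodule ℂ H) [FiniteDimensional ℂ M] :
    IsCompactOperator M.starProjection :=
  (isCompactOperator_of_locallyCompactSpace_rng M.subtypeL).comp_clm M.orthogonalProjectionOnto

theorem starProjection_mem_projections (M : Submodule ℂ H) [FiniteDimensional ℂ M] :
    M.starProjection ∈ projections H :=
  isStarProjection_starProjection

/-- `Y` sees only the component of `x` in `N(e)`, `J` only the one in `R(e)`, and their images are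
orthogonal. Pythagoras, used on both sides, gives the bound. -/
theorem norm_add_pi_smul_le {Y J e : H →L[ℂ] H} (hY : IsSelfAdjoint Y) (hYn : ‖Y‖ ≤ Real.pi)
    (hYe : Y * e = 0) (he : e ∈ projections H) (hJ : IsSelfAdjoint J) (hJJ : J * J = e)
    (heJ : e * J = J) : ‖Y + (Real.pi : ℂ) • J‖ ≤ Real.pi := by
  refine ContinuousLinearMap.opNorm_le_bound _ Real.pi_pos.le fun x => ?_
  have hYJ : Y * J = 0 := by rw [← heJ, ← mul_assoc, hYe, zero_mul]
  have h0 : inner ℂ (Y x) ((Real.pi : ℂ) • J x) = 0 := by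
    have h1 : inner ℂ (Y x) (J x) = inner ℂ x ((Y * J) x) := by
      have := ContinuousLinearMap.adjoint_inner_left Y (J x) x
      rwa [hY.adjoint_eq] at this
    rw [inner_smul_right, h1, hYJ]
    simp
  have h1 := norm_add_sq_eq_norm_sq_add_norm_sq_of_inner_eq_zero _ _ h0
  have h2 : ‖J x‖ = ‖e x‖ := by
    have a1 : inner ℂ (J x) (J x) = inner ℂ (e x) (e x) := by
      have := ContinuousLinearMap.adjoint_inner_left J (J x) x
      rw [hJ.adjoint_eq] at this
      rw [this, inner_apply_of_mem_projections he, apply_apply_of_mem_projections he, ← hJJ]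
      rfl
    rw [inner_self_eq_norm_sq_to_K, inner_self_eq_norm_sq_to_K] at a1
    exact (sq_eq_sq₀ (norm_nonneg _) (norm_nonneg _)).1 (by exact_mod_cast a1)
  have h3 : ‖Y x‖ ≤ Real.pi * ‖x - e x‖ := by
    have : Y x = Y (x - e x) := by
      have : Y (e x) = (Y * e) x := rfl
      rw [map_sub, this, hYe]; simp
    rw [this]
    exact (Y.le_opNorm _).trans (by gcongr)
  have h4 := norm_sq_apply_of_mem_projections he x
  have h5 : ‖(Real.pi : ℂ) • J x‖ = Real.pi * ‖e x‖ := by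
    rw [norm_smul, h2, Complex.norm_real, Real.norm_of_nonneg Real.pi_pos.le]
  rw [h5] at h1
  change ‖Y x + (Real.pi : ℂ) • J x‖ ≤ _
  refine abs_le_of_sq_le_sq' ?_ (by positivity) |>.2
  have h6 : ‖Y x‖ ^ 2 ≤ (Real.pi * ‖x - e x‖) ^ 2 := by gcongr
  calc ‖Y x + (Real.pi : ℂ) • J x‖ ^ 2 = ‖Y x‖ ^ 2 + (Real.pi * ‖e x‖) ^ 2 := by
        rw [sq, h1]; ring
    _ ≤ (Real.pi * ‖x - e x‖) ^ 2 + (Real.pi * ‖e x‖) ^ 2 := by gcongr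
    _ = (Real.pi * ‖x‖) ^ 2 := by rw [mul_pow Real.pi ‖x‖, h4]; ring

/-- Let `e` and `f` project onto `R(P) ∩ N(Q)` and `R(Q) ∩ N(P)`. Index zero makes their ranks
equal, so a partial isometry `W` exchanges them. Replacing `Q` by `Q' = Q + e - f`, which agrees
with `P` on this block, reduces to the case of distance less than one; adding `π (W + W*)` then
changes `Q'` back to `Q`. -/
theorem exists_generator {P Q : H →L[ℂ] H} (hP : P ∈ projections H)
    (hQ : Q ∈ projections H) (hc : IsCompactOperator (P - Q)) (hi : pairIndex P Q = 0) :
    ∃ Y : H →L[ℂ] H, IsSelfAdjoint Y ∧ IsCompactOperator Y ∧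
      symmetry P * Y = -(Y * symmetry P) ∧ ‖Y‖ ≤ Real.pi ∧
      NormedSpace.exp (Complex.I • Y) * symmetry P = symmetry Q := by
  have := finiteDimensional_range_inf_ker hP hc
  have := finiteDimensional_range_inf_ker hQ (isCompactOperator_sub_comm hc)
  have hfin : Module.finrank ℂ (P.range ⊓ Q.ker : Submodule ℂ H) =
      Module.finrank ℂ (Q.range ⊓ P.ker : Submodule ℂ H) := by
    rw [← finrank_ker_pairOperator, ← finrank_ker_pairOperator]
    rw [pairIndex_eq_finrank_ker_sub hP hQ hc] at hi
    lia
  obtain ⟨W, hW1, hW2, hW3, hW4⟩ := exists_partialIsometry _ _ hfin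
  have hp1 := starProjection_mem_projections (P.range ⊓ Q.ker)
  have hp2 := starProjection_mem_projections (Q.range ⊓ P.ker)
  have hc1 := isCompactOperator_starProjection (P.range ⊓ Q.ker)
  have hc2 := isCompactOperator_starProjection (Q.range ⊓ P.ker)
  have hm1 (x : H) : (P.range ⊓ Q.ker).starProjection x ∈ P.range ⊓ Q.ker :=
    Submodule.starProjection_apply_mem _ _
  have hm2 (x : H) : (Q.range ⊓ P.ker).starProjection x ∈ Q.range ⊓ P.ker :=
    Submodule.starProjection_apply_mem _ _
  have hs1 (x : H) (hx : x ∈ P.range ⊓ Q.ker) : (P.range ⊓ Q.ker).starProjection x = x :=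
    Submodule.starProjection_eq_self_iff.2 hx
  have hs2 (x : H) (hx : x ∈ Q.range ⊓ P.ker) : (Q.range ⊓ P.ker).starProjection x = x :=
    Submodule.starProjection_eq_self_iff.2 hx
  -- From here on the argument is algebra in `e`, `f`, `P`, `Q`, `W`, together with the membership
  -- facts recorded above.
  generalize (P.range ⊓ Q.ker).starProjection = e at *
  generalize (Q.range ⊓ P.ker).starProjection = f at *
  have hPP := hP.isIdempotentElem.eq
  have hQQ := hQ.isIdempotentElem.eq
  have hee := hp1.isIdempotentElem.eq
  have hff := hp2.isIdempotentElem.eq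
  have hPe : P * e = e := by
    ext x; exact (mem_range_iff_of_mem_projections hP).1 (hm1 x).1
  have hQe : Q * e = 0 := by ext x; exact (hm1 x).2
  have hQf : Q * f = f := by
    ext x; exact (mem_range_iff_of_mem_projections hQ).1 (hm2 x).1
  have hPf : P * f = 0 := by ext x; exact (hm2 x).2
  have heP : e * P = e := by
    have := congrArg star hPe
    rwa [star_mul, hp1.isSelfAdjoint.star_eq, hP.isSelfAdjoint.star_eq] at this
  have heQ : e * Q = 0 := by
    have := congrArg star hQe
    rwa [star_mul, hp1.isSelfAdjoint.star_eq, hQ.isSelfAdjoint.star_eq, star_zero] at this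
  have hfQ : f * Q = f := by
    have := congrArg star hQf
    rwa [star_mul, hp2.isSelfAdjoint.star_eq, hQ.isSelfAdjoint.star_eq] at this
  have hfP : f * P = 0 := by
    have := congrArg star hPf
    rwa [star_mul, hp2.isSelfAdjoint.star_eq, hP.isSelfAdjoint.star_eq, star_zero] at this
  have hef : e * f = 0 := by rw [← heP, mul_assoc, hPf, mul_zero]
  have hfe : f * e = 0 := by rw [← hPe, ← mul_assoc, hfP, zero_mul]
  have hWs1 : star W * f = star W := by
    have := congrArg star hW3
    rwa [star_mul, hp2.isSelfAdjoint.star_eq] at this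
  have hWs2 : e * star W = star W := by
    have := congrArg star hW4
    rwa [star_mul, hp1.isSelfAdjoint.star_eq] at this
  have hWW : W * W = 0 := by
    nth_rewrite 2 [← hW3]; rw [← hW4, mul_assoc, ← mul_assoc e, hef]; simp
  have hWsWs : star W * star W = 0 := by
    rw [← star_mul, hWW, star_zero]
  have heW : e * W = 0 := by rw [← hW3, ← mul_assoc, hef, zero_mul]
  have hWf : W * f = 0 := by rw [← hW4, mul_assoc, hef, mul_zero]
  have hfWs : f * star W = 0 := by rw [← hWs2, ← mul_assoc, hfe, zero_mul]
  have hWse : star W * e = 0 := by rw [← hWs1, mul_assoc, hfe, mul_zero]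
  have hPW : P * W = 0 := by rw [← hW3, ← mul_assoc, hPf, zero_mul]
  have hWP : W * P = W := by
    nth_rewrite 1 [← hW4]; rw [mul_assoc, heP, hW4]
  have hPWs : P * star W = star W := by
    nth_rewrite 1 [← hWs2]; rw [← mul_assoc, hPe, hWs2]
  have hWsP : star W * P = 0 := by rw [← hWs1, mul_assoc, hfP, mul_zero]
  let J : H →L[ℂ] H := W + star W
  have hJ : IsSelfAdjoint J := by
    change star (W + star W) = W + star W
    rw [star_add, star_star, add_comm]
  have hJJ : J * J = e + f := by
    simp only [J, mul_add, add_mul, hWW, hWsWs, hW1, hW2]; abel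
  have heJ : (e + f) * J = J := by
    simp only [J, mul_add, add_mul, hW3, heW, hWs2, hfWs]; abel
  have hJe : J * (e + f) = J := by
    simp only [J, mul_add, add_mul, hW4, hWf, hWs1, hWse]; abel
  have hJS : symmetry P * J = -(J * symmetry P) := by
    simp only [J, symmetry, mul_add, add_mul, mul_sub, sub_mul, hPW, hWP, hPWs, hWsP, one_mul,
      mul_one]
    abel
  have hef_mem : e + f ∈ projections H :=
    ⟨by change _ * _ = _; simp only [mul_add, add_mul, hee, hff, hef, hfe]; abel,
      hp1.isSelfAdjoint.add hp2.isSelfAdjoint⟩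
  let Q' : H →L[ℂ] H := Q + e - f
  have hQ' : Q' ∈ projections H := by
    refine ⟨?_, (hQ.isSelfAdjoint.add hp1.isSelfAdjoint).sub hp2.isSelfAdjoint⟩
    change _ * _ = _
    simp only [Q', mul_add, add_mul, mul_sub, sub_mul, hQQ, hee, hff, hef, hfe, hQe, hQf, heQ, hfQ]
    abel
  have hc' : IsCompactOperator (P - Q') := by
    have : P - Q' = P - Q - e + f := by simp only [Q']; abel
    rw [this]
    exact (hc.sub hc1).add hc2
  have hfx (x : H) (hx : P x = x) : f x = 0 := by
    rw [← hx]; exact congrArg (fun T : H →L[ℂ] H => T x) hfP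
  have hex (x : H) (hx : P x = 0) : e x = 0 := by
    rw [← heP]; change e (P x) = 0; rw [hx, map_zero]
  have hQex (x : H) : Q (e x) = 0 := congrArg (fun T : H →L[ℂ] H => T x) hQe
  have hQfx (x : H) : Q (f x) = f x := congrArg (fun T : H →L[ℂ] H => T x) hQf
  have hn : ‖P - Q'‖ < 1 := by
    refine norm_sub_lt_one_of_compact hP hQ' hc' (fun x hx hx' => ?_) (fun x hx hx' => ?_)
    · change Q x + e x - f x = 0 at hx'
      rw [hfx x hx, sub_zero] at hx'
      have h1 : Q x = 0 := by
        have := congrArg Q hx'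
        simpa [apply_apply_of_mem_projections hQ, hQex] using this
      have h2 : e x = x := hs1 x ⟨⟨x, hx⟩, h1⟩
      rw [h1, h2, zero_add] at hx'
      exact hx'
    · change Q x + e x - f x = x at hx
      rw [hex x hx', add_zero] at hx
      have h1 : f x = 0 := by
        have := congrArg Q hx
        simpa [apply_apply_of_mem_projections hQ, hQfx] using this
      rw [h1, sub_zero] at hx
      have h2 : f x = x := hs2 x ⟨⟨x, hx⟩, hx'⟩
      rw [← h2, h1]
  obtain ⟨Y, hYsa, hYc, hYS, hYn, hYexp, hYe⟩ := exists_generator_of_norm_lt_one hP hQ' hc' hn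
  -- `2P - 1` and `2Q' - 1` are both `+1` on `R(e)` and `-1` on `R(f)`, so their product fixes the
  -- block.
  have hYe0 : Y * (e + f) = 0 := by
    refine hYe _ ?_
    simp only [symmetry, Q', mul_add, add_mul, mul_sub, sub_mul, hee, hff, hef, hfe, hQe, hQf,
      hPe, hPf, one_mul, mul_zero, mul_assoc]
    abel
  have heY0 : (e + f) * Y = 0 := by
    have := congrArg star hYe0
    rwa [star_mul, hYsa.star_eq, hef_mem.isSelfAdjoint.star_eq, star_zero] at this
  have hYJ : Y * J = 0 := by rw [← heJ, ← mul_assoc, hYe0, zero_mul]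
  have hJY : J * Y = 0 := by rw [← hJe, mul_assoc, heY0, mul_zero]
  refine ⟨Y + (Real.pi : ℂ) • J, ?_, ?_, ?_, ?_, ?_⟩
  · refine hYsa.add ?_
    change star _ = _
    rw [star_smul, hJ.star_eq]
    simp
  · refine hYc.add (IsCompactOperator.smul ?_ _)
    have : J = (e + f) * J := heJ.symm
    rw [this]
    exact IsCompactOperator.comp_clm (f := (e + f : H →L[ℂ] H)) (hc1.add hc2) J
  · rw [mul_add, add_mul, hYS, mul_smul_comm, hJS, smul_mul_assoc]
    module
  · exact norm_add_pi_smul_le hYsa hYn hYe0 hef_mem hJ hJJ heJ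
  · let +nondep : NormedAlgebra ℚ (H →L[ℂ] H) := .restrictScalars ℚ ℂ _
    have hsplit : Complex.I • (Y + (Real.pi : ℂ) • J) =
        Complex.I • Y + (Complex.I * Real.pi) • J := by module
    -- The exchange contributes the factor `1 - 2(e + f)`, which commutes with `2P - 1`, and `(2Q' -
    -- 1)(1 - 2(e + f)) = 2Q - 1`.
    rw [hsplit, NormedSpace.exp_add_of_commute, hYexp, exp_I_pi_smul hJJ heJ hJe]
    · simp only [symmetry, Q', mul_add, add_mul, mul_sub, sub_mul, hee, hff, hef, hfe, hQe, hQf,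
        hPe, hPf, heP, hfP, hPP, one_mul, mul_one, mul_zero, zero_mul, mul_assoc]
      abel
    · change _ * _ = _ * _
      simp [hYJ, hJY]

end

section

/-! ### One-parameter geodesics -/

variable {H : Type*} [NormedAddCommGroup H] [InnerProductSpace ℂ H] [CompleteSpace H]

/-- The curve `t ↦ e^{itY/2} P e^{-itY/2}`, for `Y` anticommuting with `2P - 1`. -/
def geodesicOf (P Y : H →L[ℂ] H) (t : ℝ) : H →L[ℂ] H :=
  (1 / 2 : ℂ) • (1 + NormedSpace.exp (t • (Complex.I • Y)) * symmetry P)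

/-- Anticommutation turns `S e^{-itY}` into `e^{itY} S` for `S = 2P - 1`, so the unitary `e^{itY} S`
is its own adjoint and hence a symmetry. -/
theorem isSelfAdjoint_exp_mul {P Y : H →L[ℂ] H} (hP : P ∈ projections H) (hY : IsSelfAdjoint Y)
    (hYP : symmetry P * Y = -(Y * symmetry P)) (t : ℝ) :
    IsSelfAdjoint (NormedSpace.exp (t • (Complex.I • Y)) * symmetry P) ∧
    (NormedSpace.exp (t • (Complex.I • Y)) * symmetry P) *
      (NormedSpace.exp (t • (Complex.I • Y)) * symmetry P) = 1 := by
  let +nondep : NormedAlgebra ℚ (H →L[ℂ] H) := .restrictScalars ℚ ℂ _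
  have h1 : symmetry P * NormedSpace.exp (-(t • (Complex.I • Y))) =
      NormedSpace.exp (t • (Complex.I • Y)) * symmetry P := by
    refine semiconjBy_exp ?_
    rw [mul_neg, mul_smul_comm, mul_smul_comm, hYP, smul_neg, smul_neg, neg_neg, smul_mul_assoc,
      smul_mul_assoc]
  have h2 : star (NormedSpace.exp (t • (Complex.I • Y))) =
      NormedSpace.exp (-(t • (Complex.I • Y))) := by
    rw [NormedSpace.star_exp, star_smul, star_smul, hY.star_eq]
    simp
  have h3 : NormedSpace.exp (t • (Complex.I • Y)) * NormedSpace.exp (-(t • (Complex.I • Y))) = 1 := by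
    rw [← NormedSpace.exp_add_of_commute ((Commute.refl _).neg_right), add_neg_cancel,
      NormedSpace.exp_zero]
  constructor
  · change star _ = _
    rw [star_mul, (isSelfAdjoint_symmetry hP).star_eq, h2, h1]
  · nth_rewrite 2 [← h1]
    rw [mul_assoc, ← mul_assoc (symmetry P), symmetry_mul_self hP, one_mul, h3]

theorem geodesicOf_mem_projections {P Y : H →L[ℂ] H} (hP : P ∈ projections H)
    (hY : IsSelfAdjoint Y) (hYP : symmetry P * Y = -(Y * symmetry P)) (t : ℝ) :
    geodesicOf P Y t ∈ projections H :=
  let h := isSelfAdjoint_exp_mul hP hY hYP t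
  mem_projections_of_symmetry h.1 h.2

theorem half_one_add_symmetry (P : H →L[ℂ] H) : (1 / 2 : ℂ) • (1 + symmetry P) = P := by
  simp only [symmetry]; module

theorem geodesicOf_zero (P Y : H →L[ℂ] H) : geodesicOf P Y 0 = P := by
  rw [geodesicOf, zero_smul, NormedSpace.exp_zero, one_mul, half_one_add_symmetry]

theorem geodesicOf_one {P Q Y : H →L[ℂ] H}
    (h : NormedSpace.exp (Complex.I • Y) * symmetry P = symmetry Q) : geodesicOf P Y 1 = Q := by
  rw [geodesicOf, one_smul, h, half_one_add_symmetry]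

theorem hasDerivAt_exp_smul_mul (Z X : H →L[ℂ] H) (t : ℝ) :
    HasDerivAt (fun t : ℝ => NormedSpace.exp (t • Z) * X) (NormedSpace.exp (t • Z) * (Z * X)) t := by
  have h := (hasDerivAt_exp_smul_const (𝕂 := ℝ) Z t).mul_const X
  rwa [mul_assoc] at h

theorem hasDerivAt_geodesicOf (P Y : H →L[ℂ] H) (t : ℝ) :
    HasDerivAt (geodesicOf P Y) ((1 / 2 : ℂ) •
      (NormedSpace.exp (t • (Complex.I • Y)) * (Complex.I • Y * symmetry P))) t :=
  ((hasDerivAt_exp_smul_mul (Complex.I • Y) (symmetry P) t).const_add 1).const_smul (1 / 2 : ℂ)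

theorem contDiff_geodesicOf (P Y : H →L[ℂ] H) : ContDiff ℝ ∞ (geodesicOf P Y) := by
  have h : ContDiff ℝ ∞ (NormedSpace.exp : (H →L[ℂ] H) → (H →L[ℂ] H)) :=
    AnalyticOnNhd.contDiff fun x _ => NormedSpace.exp_analytic (𝕂 := ℝ) x
  have h1 : ContDiff ℝ ∞ fun t : ℝ => NormedSpace.exp (t • (Complex.I • Y)) :=
    h.comp (contDiff_id.smul contDiff_const)
  exact (contDiff_const.add (h1.mul contDiff_const)).const_smul (1 / 2 : ℂ)

/-- Up to sign the velocity is half the product of a symmetry and `iY`. -/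
theorem norm_deriv_geodesicOf_le {P Y : H →L[ℂ] H} (hP : P ∈ projections H)
    (hY : IsSelfAdjoint Y) (hYP : symmetry P * Y = -(Y * symmetry P)) (t : ℝ) :
    ‖deriv (geodesicOf P Y) t‖ ≤ ‖Y‖ / 2 := by
  rw [(hasDerivAt_geodesicOf P Y t).deriv, norm_smul]
  have h : NormedSpace.exp (t • (Complex.I • Y)) * (Complex.I • Y * symmetry P) =
      -(NormedSpace.exp (t • (Complex.I • Y)) * symmetry P * (Complex.I • Y)) := by
    rw [mul_assoc, mul_smul_comm, hYP, smul_neg, mul_neg, neg_neg, smul_mul_assoc]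
  rw [h, norm_neg]
  have h1 := isSelfAdjoint_exp_mul hP hY hYP t
  have h2 := norm_le_one_of_mul_self_eq_one h1.1 h1.2
  have h3 := norm_mul_le (NormedSpace.exp (t • (Complex.I • Y)) * symmetry P) (Complex.I • Y)
  have h4 : ‖Complex.I • Y‖ = ‖Y‖ := by rw [norm_smul, Complex.norm_I, one_mul]
  rw [h4] at h3
  have h5 : ‖(1 / 2 : ℂ)‖ = 1 / 2 := by norm_num
  rw [h5]
  nlinarith [norm_nonneg Y]

theorem norm_geodesicOf_sub_le {P Y : H →L[ℂ] H} (hP : P ∈ projections H)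
    (hY : IsSelfAdjoint Y) (hYP : symmetry P * Y = -(Y * symmetry P)) (s t : ℝ) :
    ‖geodesicOf P Y t - geodesicOf P Y s‖ ≤ ‖Y‖ / 2 * |t - s| := by
  have := Convex.norm_image_sub_le_of_norm_deriv_le (𝕜 := ℝ) (f := geodesicOf P Y) (C := ‖Y‖ / 2)
    (s := univ) (x := s) (y := t) (fun x _ => (hasDerivAt_geodesicOf P Y x).differentiableAt)
    (fun x _ => norm_deriv_geodesicOf_le hP hY hYP x) convex_univ (mem_univ _) (mem_univ _)
  exact this

theorem tangentProj_eq_zero_of_commute {P X : H →L[ℂ] H} (hP : P ∈ projections H)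
    (h : Commute P X) : tangentProj P X = 0 := by
  have hPP := hP.isIdempotentElem.eq
  have h1 : P * X * P = P * X := by rw [mul_assoc, ← h.eq, ← mul_assoc, hPP]
  rw [tangentProj, mul_sub, mul_one, h1, sub_self, sub_mul, sub_mul, one_mul, h1, ← h.eq, sub_self,
    add_zero]

/-- With `Z = iY`, the acceleration is `½ Z² e^{tZ} (2P - 1)`. Since `Z²` commutes with `e^{tZ}`
and, by anticommuting twice, with `2P - 1`, the acceleration commutes with the curve and has no
tangential part. -/
theorem isGeodesic_geodesicOf {P Y : H →L[ℂ] H} (hP : P ∈ projections H)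
    (hY : IsSelfAdjoint Y) (hYP : symmetry P * Y = -(Y * symmetry P)) :
    IsGeodesic (geodesicOf P Y) := by
  refine ⟨(contDiff_geodesicOf P Y).contDiffOn, fun t _ => geodesicOf_mem_projections hP hY hYP t,
    fun t ht => ?_⟩
  have hu := uniqueDiffOn_Icc (zero_lt_one' ℝ)
  set Z := Complex.I • Y with hZ
  have h1 : ∀ t ∈ Icc (0 : ℝ) 1, derivWithin (geodesicOf P Y) (Icc 0 1) t =
      (1 / 2 : ℂ) • (NormedSpace.exp (t • Z) * (Z * symmetry P)) := fun t ht =>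
    (hasDerivAt_geodesicOf P Y t).hasDerivWithinAt.derivWithin (hu t ht)
  have h2 : derivWithin (derivWithin (geodesicOf P Y) (Icc 0 1)) (Icc 0 1) t =
      (1 / 2 : ℂ) • (NormedSpace.exp (t • Z) * (Z * (Z * symmetry P))) := by
    rw [derivWithin_congr h1 (h1 t ht)]
    exact ((hasDerivAt_exp_smul_mul Z (Z * symmetry P) t).const_smul
      (1 / 2 : ℂ)).hasDerivWithinAt.derivWithin (hu t ht)
  have hZP : symmetry P * Z = -(Z * symmetry P) := by
    rw [hZ, mul_smul_comm, hYP, smul_neg, smul_mul_assoc]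
  have hPZZ : Commute (Z * Z) (symmetry P) := by
    change _ = _
    rw [← mul_assoc (symmetry P), hZP, neg_mul, mul_assoc Z (symmetry P) Z, hZP, mul_neg, neg_neg,
      mul_assoc]
  have hexp : Commute Z (NormedSpace.exp (t • Z)) := by
    have : Z * (t • Z) = (t • Z) * Z := by
      rw [mul_smul_comm t Z Z, smul_mul_assoc t Z Z]
    exact semiconjBy_exp this
  have hcomm : Commute (Z * Z) (NormedSpace.exp (t • Z) * symmetry P) :=
    (hexp.mul_left hexp).mul_right hPZZ
  have h3 : NormedSpace.exp (t • Z) * (Z * (Z * symmetry P)) =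
      Z * Z * (NormedSpace.exp (t • Z) * symmetry P) := by
    rw [← mul_assoc Z Z, hPZZ.eq, ← mul_assoc, hcomm.eq]
  have h4 : Commute (geodesicOf P Y t)
      ((1 / 2 : ℂ) • (NormedSpace.exp (t • Z) * (Z * (Z * symmetry P)))) := by
    rw [h3]
    refine Commute.smul_left (Commute.smul_right ?_ _) _
    exact (Commute.one_left _).add_left (hcomm.symm.mul_right (Commute.refl _))
  rw [covDeriv, h2]
  exact tangentProj_eq_zero_of_commute (geodesicOf_mem_projections hP hY hYP t) h4

/-- Past the constant term, the partial sums of the exponential series are compact and converge in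
norm. -/
theorem isCompactOperator_exp_sub_one {Z : H →L[ℂ] H} (hZ : IsCompactOperator Z) :
    IsCompactOperator (NormedSpace.exp Z - 1 : H →L[ℂ] H) := by
  have h := NormedSpace.exp_series_hasSum_exp' (𝕂 := ℂ) Z
  have h1 := (hasSum_nat_add_iff' 1).2 h
  simp only [Finset.sum_range_one, Nat.factorial_zero, Nat.cast_one, inv_one, pow_zero,
    one_smul] at h1
  refine isCompactOperator_of_tendsto h1 (Filter.Eventually.of_forall fun s => ?_)
  refine (compactOperator (RingHom.id ℂ) H H).sum_mem fun n _ => ?_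
  refine (compactOperator (RingHom.id ℂ) H H).smul_mem _ ?_
  rw [pow_succ]
  exact hZ.clm_comp (Z ^ n)

theorem isCompactOperator_geodesicOf_sub {P Y : H →L[ℂ] H} (hY : IsCompactOperator Y) (t : ℝ) :
    IsCompactOperator (geodesicOf P Y t - P) := by
  have h : geodesicOf P Y t - P =
      (1 / 2 : ℂ) • ((NormedSpace.exp (t • (Complex.I • Y)) - 1) * symmetry P) := by
    have h0 := half_one_add_symmetry P
    nth_rewrite 2 [← h0]
    rw [geodesicOf, ← smul_sub, sub_mul, one_mul, add_sub_add_left_eq_sub]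
  rw [h]
  refine IsCompactOperator.smul ?_ _
  have hZ : IsCompactOperator (t • (Complex.I • Y) : H →L[ℂ] H) := (hY.smul Complex.I).smul t
  exact (isCompactOperator_exp_sub_one hZ).comp_clm (symmetry P)

/-- The speed is at most `π/2`, so the point at time `t / 2` is within `π/4 < 1` of both ends, and
its nullspace serves as the complement. -/
theorem haveCommonComplement_geodesicOf {P Y : H →L[ℂ] H} (hP : P ∈ projections H)
    (hY : IsSelfAdjoint Y) (hYP : symmetry P * Y = -(Y * symmetry P)) (hYn : ‖Y‖ ≤ Real.pi)
    {t : ℝ} (ht : t ∈ Icc (0 : ℝ) 1) : HaveCommonComplement P.range (geodesicOf P Y t).range := by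
  have hb (a b : ℝ) (hab : |a - b| ≤ 1 / 2) : ‖geodesicOf P Y a - geodesicOf P Y b‖ < 1 := by
    refine (norm_geodesicOf_sub_le hP hY hYP b a).trans_lt ?_
    have := Real.pi_lt_four
    nlinarith [norm_nonneg Y, abs_nonneg (a - b)]
  refine haveCommonComplement_of_norm_sub_lt_one hP (geodesicOf_mem_projections hP hY hYP t)
    (geodesicOf_mem_projections hP hY hYP (t / 2)) ?_ (hb _ _ ?_)
  · have := hb 0 (t / 2) (by rw [abs_le]; constructor <;> linarith [ht.1, ht.2])
    rwa [geodesicOf_zero] at this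
  · rw [abs_le]; constructor <;> linarith [ht.1, ht.2]

end

section

/-! ### Lower bounds for the length of curves of projections -/

variable {H : Type*} [NormedAddCommGroup H] [InnerProductSpace ℂ H] [CompleteSpace H]

/-- The cosine `2‖Px‖² - 1` of twice the angle between a unit vector `x` and `R(P)`. -/
def cosDoubleAngle (P : H →L[ℂ] H) (x : H) : ℝ := 2 * (inner ℂ x (P x)).re - 1

theorem re_inner_apply_of_mem_projections {P : H →L[ℂ] H} (hP : P ∈ projections H) (x : H) :
    (inner ℂ x (P x)).re = ‖P x‖ ^ 2 := by
  have h : inner ℂ x (P x) = inner ℂ (P x) (P x) := by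
    rw [inner_apply_of_mem_projections hP, apply_apply_of_mem_projections hP]
  rw [h, inner_self_eq_norm_sq_to_K]
  norm_cast

theorem one_sub_cosDoubleAngle_sq {P : H →L[ℂ] H} (hP : P ∈ projections H) {x : H}
    (hx : ‖x‖ = 1) : 1 - cosDoubleAngle P x ^ 2 = (2 * (‖P x‖ * ‖x - P x‖)) ^ 2 := by
  have h := norm_sq_apply_of_mem_projections hP x
  rw [hx] at h
  rw [cosDoubleAngle, re_inner_apply_of_mem_projections hP]
  have h1 : ‖x - P x‖ ^ 2 = 1 - ‖P x‖ ^ 2 := by linarith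
  rw [mul_pow, mul_pow, h1]
  ring

/-- Tangent vectors to the set of projections at `P` are `P`-codiagonal. -/
theorem abs_re_inner_tangent_le {P D : H →L[ℂ] H} (hP : P ∈ projections H)
    (hD : D = D * P + P * D) (x : H) :
    |(inner ℂ x (D x)).re| ≤ 2 * ‖D‖ * (‖P x‖ * ‖x - P x‖) := by
  have hPP := hP.isIdempotentElem.eq
  have hPDP : P * D * P = 0 := by
    have h1 : P * D = P * D * P + P * D := by
      nth_rewrite 1 [hD]
      rw [mul_add, ← mul_assoc, ← mul_assoc, hPP]
    exact right_eq_add.1 h1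
  have hDx : D x = P (D (x - P x)) + (D (P x)) := by
    have h1 : P (D (P x)) = 0 := congrArg (fun T : H →L[ℂ] H => T x) hPDP
    have h2 : D x = D (P x) + P (D x) := congrArg (fun T : H →L[ℂ] H => T x) hD
    rw [map_sub, map_sub, h1, sub_zero, add_comm, ← h2]
  have hDP : inner ℂ x (D (P x)) = inner ℂ (x - P x) (D (P x)) := by
    have h1 : P (D (P x)) = 0 := congrArg (fun T : H →L[ℂ] H => T x) hPDP
    rw [inner_sub_left, inner_apply_of_mem_projections hP, h1, inner_zero_right, sub_zero]
  rw [hDx, inner_add_right, ← inner_apply_of_mem_projections hP, hDP]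
  refine (Complex.abs_re_le_norm _).trans ((norm_add_le _ _).trans ?_)
  have a1 : ‖inner ℂ (P x) (D (x - P x))‖ ≤ ‖P x‖ * (‖D‖ * ‖x - P x‖) :=
    (norm_inner_le_norm _ _).trans (by gcongr; exact D.le_opNorm _)
  have a2 : ‖inner ℂ (x - P x) (D (P x))‖ ≤ ‖x - P x‖ * (‖D‖ * ‖P x‖) :=
    (norm_inner_le_norm _ _).trans (by gcongr; exact D.le_opNorm _)
  linarith

theorem hasDerivAt_cosDoubleAngle {γ : ℝ → (H →L[ℂ] H)} {D : H →L[ℂ] H} {t : ℝ}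
    (h : HasDerivAt γ D t) (x : H) :
    HasDerivAt (fun s => cosDoubleAngle (γ s) x) (2 * (inner ℂ x (D x)).re) t := by
  let ev : (H →L[ℂ] H) →L[ℝ] ℝ := Complex.reCLM ∘L
    ((innerSL ℂ x ∘L ContinuousLinearMap.apply ℂ H x).restrictScalars ℝ)
  have h1 : HasDerivAt (fun s => ev (γ s)) (ev D) t := ev.hasFDerivAt.comp_hasDerivAt t h
  exact (h1.const_mul 2).sub_const 1

theorem tangent_eq_of_hasDerivAt {γ : ℝ → (H →L[ℂ] H)} {D : H →L[ℂ] H} {t : ℝ}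
    (h : HasDerivAt γ D t) (hγ : ∀ᶠ s in nhds t, γ s ∈ projections H) :
    D = D * γ t + γ t * D := by
  have h1 := h.mul h
  refine h.unique (h1.congr_of_eventuallyEq ?_)
  filter_upwards [hγ] with s hs
  exact hs.isIdempotentElem.eq.symm

theorem mul_cosDoubleAngle_sq_lt_one {P : H →L[ℂ] H} (hP : P ∈ projections H) {x : H}
    (hx : ‖x‖ = 1) {r : ℝ} (hr0 : 0 < r) (hr1 : r < 1) : (r * cosDoubleAngle P x) ^ 2 < 1 := by
  have := one_sub_cosDoubleAngle_sq hP hx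
  have h2 : cosDoubleAngle P x ^ 2 ≤ 1 := by nlinarith [sq_nonneg (2 * (‖P x‖ * ‖x - P x‖))]
  have h3 : r ^ 2 < 1 := by nlinarith
  rw [mul_pow]
  nlinarith [sq_nonneg r]

/-- The factor `r < 1` keeps the argument away from `±1`, where `arccos` is not differentiable. With
`m = ‖P x‖ ‖x - P x‖`, the cosine moves at rate at most `4 ‖D‖ m`, while `√(1 - c²) = 2m`; so `m`
cancels. -/
theorem exists_hasDerivAt_arccos {γ : ℝ → (H →L[ℂ] H)} {D : H →L[ℂ] H} {t : ℝ}
    (h : HasDerivAt γ D t) (hγ : ∀ᶠ s in nhds t, γ s ∈ projections H) {x : H} (hx : ‖x‖ = 1)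
    {r : ℝ} (hr0 : 0 < r) (hr1 : r < 1) :
    ∃ d, HasDerivAt (fun s => Real.arccos (r * cosDoubleAngle (γ s) x)) d t ∧ d ≤ 2 * ‖D‖ := by
  have hP := hγ.self_of_nhds
  have hlt := mul_cosDoubleAngle_sq_lt_one hP hx hr0 hr1
  set c := cosDoubleAngle (γ t) x with hc
  have hc1 := one_sub_cosDoubleAngle_sq hP hx
  rw [← hc] at hc1
  have hne1 : r * c ≠ -1 := by intro h0; rw [h0] at hlt; norm_num at hlt
  have hne2 : r * c ≠ 1 := by intro h0; rw [h0] at hlt; norm_num at hlt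
  have hd := (Real.hasDerivAt_arccos hne1 hne2).comp t
    ((hasDerivAt_cosDoubleAngle h x).const_mul r)
  refine ⟨_, hd, ?_⟩
  have hb := abs_re_inner_tangent_le hP (tangent_eq_of_hasDerivAt h hγ) x
  set m := ‖(γ t) x‖ * ‖x - (γ t) x‖
  have hm : 0 ≤ m := by positivity
  have hs : 0 < √(1 - (r * c) ^ 2) := Real.sqrt_pos.2 (by linarith)
  -- `(2rm)² = r² - (rc)²`, and `r² < 1`.
  have hs2 : r * (2 * m) ≤ √(1 - (r * c) ^ 2) := by
    refine Real.le_sqrt_of_sq_le ?_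
    have : (r * (2 * m)) ^ 2 = r ^ 2 - (r * c) ^ 2 := by
      rw [mul_pow, ← hc1]; ring
    rw [this]
    nlinarith
  have e : -(1 / √(1 - (r * c) ^ 2)) * (r * (2 * (inner ℂ x (D x)).re)) =
      (r * (2 * -(inner ℂ x (D x)).re)) / √(1 - (r * c) ^ 2) := by ring
  rw [e, div_le_iff₀ hs]
  have h1 : -(inner ℂ x (D x)).re ≤ 2 * ‖D‖ * m := (neg_le_abs _).trans hb
  calc r * (2 * -(inner ℂ x (D x)).re) ≤ r * (2 * (2 * ‖D‖ * m)) := by gcongr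
    _ = 2 * ‖D‖ * (r * (2 * m)) := by ring
    _ ≤ _ := by gcongr

theorem intervalIntegrable_norm_deriv {E : Type*} [NormedAddCommGroup E] [NormedSpace ℝ E]
    {γ : ℝ → E} {p q : ℝ} (hpq : p < q) (hγ : ContDiffOn ℝ 1 γ (Icc p q)) :
    IntervalIntegrable (fun t => ‖deriv γ t‖) MeasureTheory.volume p q := by
  have h : ContinuousOn (fun t => ‖derivWithin γ (Icc p q) t‖) (uIcc p q) := by
    rw [uIcc_of_le hpq.le]
    exact (hγ.continuousOn_derivWithin (uniqueDiffOn_Icc hpq) le_rfl).norm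
  refine h.intervalIntegrable.congr_uIoo ?_
  rw [uIoo_of_le hpq.le]
  intro t ht
  change ‖_‖ = ‖_‖
  rw [derivWithin_of_mem_nhds (Icc_mem_nhds ht.1 ht.2)]

theorem arccos_sub_arccos_le_integral {γ : ℝ → (H →L[ℂ] H)} {p q : ℝ} (hpq : p < q)
    (hγ : ContDiffOn ℝ 1 γ (Icc p q)) (hγP : ∀ t ∈ Icc p q, γ t ∈ projections H) {x : H}
    (hx : ‖x‖ = 1) {r : ℝ} (hr0 : 0 < r) (hr1 : r < 1) :
    Real.arccos (r * cosDoubleAngle (γ q) x) - Real.arccos (r * cosDoubleAngle (γ p) x) ≤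
      ∫ t in p..q, 2 * ‖deriv γ t‖ := by
  have hder : ∀ t ∈ Ioo p q, ∃ d,
      HasDerivAt (fun s => Real.arccos (r * cosDoubleAngle (γ s) x)) d t ∧
        d ≤ 2 * ‖deriv γ t‖ := fun t ht => by
    have hn := Icc_mem_nhds ht.1 ht.2
    have hd : DifferentiableAt ℝ γ t :=
      ((hγ.differentiableOn one_ne_zero) t (Ioo_subset_Icc_self ht)).differentiableAt hn
    exact exists_hasDerivAt_arccos hd.hasDerivAt (Filter.mem_of_superset hn hγP) hx hr0 hr1
  choose! d hd1 hd2 using hder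
  refine intervalIntegral.sub_le_integral_of_hasDeriv_right_of_le
    (g := fun s => Real.arccos (r * cosDoubleAngle (γ s) x)) (g' := d) hpq.le ?_
    (fun t ht => (hd1 t ht).hasDerivWithinAt) ?_ hd2
  · refine Real.continuous_arccos.comp_continuousOn (continuousOn_const.mul ?_)
    refine (continuousOn_const.mul (Complex.continuous_re.comp_continuousOn ?_)).sub
      continuousOn_const
    exact continuousOn_const.inner ((hγ.continuousOn).clm_apply continuousOn_const)
  · have := (intervalIntegrable_norm_deriv hpq hγ).const_mul 2
    rwa [intervalIntegrable_iff_integrableOn_Icc_of_le hpq.le] at this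

theorem IsPiecewiseC1.comp_clm {E F : Type*} [NormedAddCommGroup E] [NormedSpace ℝ E]
    [NormedAddCommGroup F] [NormedSpace ℝ F] {γ : ℝ → E} (h : IsPiecewiseC1 γ) (L : E →L[ℝ] F) :
    IsPiecewiseC1 (fun t => L (γ t)) := by
  obtain ⟨n, s, hs, h0, h1, hi⟩ := h
  exact ⟨n, s, hs, h0, h1, fun i => L.contDiff.comp_contDiffOn (hi i)⟩

theorem IsPiecewiseC1.intervalIntegrable {E : Type*} [NormedAddCommGroup E] [NormedSpace ℝ E]
    {γ : ℝ → E} (h : IsPiecewiseC1 γ) :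
    IntervalIntegrable (fun t => ‖deriv γ t‖) MeasureTheory.volume 0 1 := by
  obtain ⟨n, s, hs, h0, h1, hi⟩ := h
  have key : ∀ i : Fin (n + 1),
      IntervalIntegrable (fun t => ‖deriv γ t‖) MeasureTheory.volume 0 (s i) := by
    intro i
    induction i using Fin.induction with
    | zero => rw [h0]
    | succ i ih =>
      exact ih.trans (intervalIntegrable_norm_deriv (hs i.castSucc_lt_succ) (hi i))
  exact h1 ▸ key (Fin.last n)

theorem IsPiecewiseC1.arccos_le_integral {γ : ℝ → (H →L[ℂ] H)} (h : IsPiecewiseC1 γ)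
    (hγP : ∀ t ∈ Icc (0 : ℝ) 1, γ t ∈ projections H) {x : H}
    (hx : ‖x‖ = 1) {r : ℝ} (hr0 : 0 < r) (hr1 : r < 1) :
    Real.arccos (r * cosDoubleAngle (γ 1) x) - Real.arccos (r * cosDoubleAngle (γ 0) x) ≤
      ∫ t in (0 : ℝ)..1, 2 * ‖deriv γ t‖ := by
  obtain ⟨n, s, hs, h0, h1, hi⟩ := h
  have hI : ∀ i : Fin (n + 1), s i ∈ Icc (0 : ℝ) 1 := fun i =>
    ⟨h0 ▸ hs.monotone (Fin.zero_le i), h1 ▸ hs.monotone (Fin.le_last i)⟩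
  have key : ∀ i : Fin (n + 1),
      IntervalIntegrable (fun t => ‖deriv γ t‖) MeasureTheory.volume 0 (s i) ∧
      Real.arccos (r * cosDoubleAngle (γ (s i)) x) - Real.arccos (r * cosDoubleAngle (γ 0) x) ≤
        ∫ t in (0 : ℝ)..(s i), 2 * ‖deriv γ t‖ := by
    intro i
    induction i using Fin.induction with
    | zero => rw [h0]; exact ⟨IntervalIntegrable.refl, by simp⟩
    | succ i ih =>
      have hlt := hs i.castSucc_lt_succ
      have hint := intervalIntegrable_norm_deriv hlt (hi i)
      refine ⟨ih.1.trans hint, ?_⟩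
      rw [← intervalIntegral.integral_add_adjacent_intervals (ih.1.const_mul 2) (hint.const_mul 2)]
      have := arccos_sub_arccos_le_integral hlt (hi i)
        (fun t ht => hγP t ⟨(hI _).1.trans ht.1, ht.2.trans (hI _).2⟩) hx hr0 hr1
      linarith [ih.2]
  exact h1 ▸ (key (Fin.last n)).2

/-- Let `r` increase to `1` in the regularised estimate; the initial angle vanishes because `x` lies
in the range of `γ 0`. -/
theorem IsPiecewiseC1.arccos_le_length {γ : ℝ → (H →L[ℂ] H)} (h : IsPiecewiseC1 γ)
    (hγP : ∀ t ∈ Icc (0 : ℝ) 1, γ t ∈ projections H) {x : H}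
    (hx : ‖x‖ = 1) (hx0 : γ 0 x = x) :
    Real.arccos (cosDoubleAngle (γ 1) x) ≤ 2 * ∫ t in (0 : ℝ)..1, ‖deriv γ t‖ := by
  rw [← intervalIntegral.integral_const_mul]
  have hc0 : cosDoubleAngle (γ 0) x = 1 := by
    rw [cosDoubleAngle, hx0, inner_self_eq_norm_sq_to_K, hx]; norm_num
  have hcont (c : ℝ) : Filter.Tendsto (fun r : ℝ => Real.arccos (r * c)) (nhdsWithin 1 (Iio 1))
      (nhds (Real.arccos c)) := by
    have : Continuous fun r : ℝ => Real.arccos (r * c) := by fun_prop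
    have h := this.tendsto 1
    rw [one_mul] at h
    exact h.mono_left nhdsWithin_le_nhds
  have hlim := (hcont (cosDoubleAngle (γ 1) x)).sub (hcont (cosDoubleAngle (γ 0) x))
  rw [hc0, Real.arccos_one, sub_zero] at hlim
  refine le_of_tendsto hlim ?_
  filter_upwards [Ioo_mem_nhdsLT (zero_lt_one' ℝ)] with r hr
  have := h.arccos_le_integral hγP hx hr.1 hr.2
  rwa [hc0] at this

end

section

/-! ### Minimality -/

variable {H : Type*} [NormedAddCommGroup H] [InnerProductSpace ℂ H] [CompleteSpace H]

/-- The rank-one operator `B` built from `v` intertwines the scalar `c` with `T`, hence also their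
exponentials. -/
theorem exp_apply_eigenvector {T : H →L[ℂ] H} {v : H} {c : ℂ} (h : T v = c • v) :
    NormedSpace.exp T v = Complex.exp c • v := by
  by_cases hv : v = 0
  · simp [hv]
  let B : H →L[ℂ] H := InnerProductSpace.rankOne ℂ v v
  have hB (x : H) : B x = inner ℂ v x • v := rfl
  have h1 : B * (c • (1 : H →L[ℂ] H)) = T * B := by
    ext x
    change B (c • x) = T (B x)
    rw [map_smul, hB, map_smul, h, smul_comm]
  have h2 := congrArg (fun S : H →L[ℂ] H => S v) (semiconjBy_exp h1)
  rw [exp_smul_one] at h2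
  have h3 : B (Complex.exp c • v) = NormedSpace.exp T (B v) := h2
  rw [map_smul, hB, map_smul, smul_comm] at h3
  exact (smul_right_injective H (inner_self_ne_zero.2 hv) h3).symm

/-- Take `Y v = r v` with `|r| = ‖Y‖`. Then `w = (2P - 1) v` has eigenvalue `-r`, is orthogonal to
`v` and has the same norm, and `v + w` lies in `R(P)`. Since `2Q - 1` sends it to `e^{ir} v +
e^{-ir} w`, the normalised inner product is `cos r`. -/
theorem exists_cosDoubleAngle_eq_cos_norm {P Q Y : H →L[ℂ] H} (hP : P ∈ projections H)
    (hY : IsSelfAdjoint Y) (hYc : IsCompactOperator Y)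
    (hYP : symmetry P * Y = -(Y * symmetry P))
    (hQ : NormedSpace.exp (Complex.I • Y) * symmetry P = symmetry Q) (hY0 : Y ≠ 0) :
    ∃ x : H, ‖x‖ = 1 ∧ P x = x ∧ cosDoubleAngle Q x = Real.cos ‖Y‖ := by
  obtain ⟨v, r, hv, hr, hYv⟩ := exists_eigenvector_norm hY hYc hY0
  have hSS (x : H) : symmetry P (symmetry P x) = x :=
    congrArg (fun T : H →L[ℂ] H => T x) (symmetry_mul_self hP)
  have hSin (x y : H) : inner ℂ (symmetry P x) y = inner ℂ x (symmetry P y) := by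
    have := ContinuousLinearMap.adjoint_inner_left (symmetry P) y x
    rwa [(isSelfAdjoint_symmetry hP).adjoint_eq] at this
  have hr0 : (r : ℂ) ≠ 0 := by
    rw [Complex.ofReal_ne_zero]
    rintro rfl
    rw [abs_zero] at hr
    exact hY0 (norm_eq_zero.1 hr.symm)
  set w := symmetry P v with hw
  have hYw : Y w = (-r : ℂ) • w := by
    have : symmetry P (Y v) = -(Y w) := congrArg (fun T : H →L[ℂ] H => T v) hYP
    rw [hYv, map_smul, ← hw] at this
    rw [neg_smul, this, neg_neg]
  have hvw : inner ℂ v w = 0 := by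
    have h1 := ContinuousLinearMap.adjoint_inner_left Y w v
    rw [hY.adjoint_eq, hYv, hYw, inner_smul_left, inner_smul_right, Complex.conj_ofReal] at h1
    have h2 : (r : ℂ) * inner ℂ v w = 0 := by linear_combination (1 / 2 : ℂ) * h1
    exact (mul_eq_zero.1 h2).resolve_left hr0
  have hwv : inner ℂ w v = 0 := inner_eq_zero_symm.1 hvw
  have hww : inner ℂ w w = inner ℂ v v := by rw [hw, hSin, hSS]
  have hxx : inner ℂ (v + w) (v + w) = 2 * inner ℂ v v := by
    rw [inner_add_left, inner_add_right, inner_add_right, hvw, hwv, hww]; ring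
  have hne : v + w ≠ 0 := by
    intro h0
    rw [h0, inner_zero_left] at hxx
    exact hv (inner_self_eq_zero.1 ((mul_eq_zero.1 hxx.symm).resolve_left two_ne_zero))
  have hSx : symmetry P (v + w) = v + w := by rw [map_add, ← hw, hw, hSS, add_comm]
  have hPx : P (v + w) = v + w := by
    have h1 : symmetry P (v + w) = P (v + w) + P (v + w) - (v + w) := rfl
    rw [hSx] at h1
    have h2 : (2 : ℂ) • P (v + w) = (2 : ℂ) • (v + w) := by
      rw [two_smul, two_smul, ← sub_eq_iff_eq_add]; exact h1.symm
    exact smul_right_injective H (two_ne_zero : (2 : ℂ) ≠ 0) h2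
  have hev : NormedSpace.exp (Complex.I • Y) v = Complex.exp (r * Complex.I) • v :=
    exp_apply_eigenvector (by
      change Complex.I • Y v = _
      rw [hYv, smul_smul, mul_comm])
  have hew : NormedSpace.exp (Complex.I • Y) w = Complex.exp ((-r : ℝ) * Complex.I) • w :=
    exp_apply_eigenvector (by
      change Complex.I • Y w = _
      rw [hYw, smul_smul, mul_comm]; push_cast; rfl)
  have hQx : symmetry Q (v + w) =
      Complex.exp (r * Complex.I) • v + Complex.exp ((-r : ℝ) * Complex.I) • w := by
    rw [← hQ]
    change NormedSpace.exp (Complex.I • Y) (symmetry P (v + w)) = _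
    rw [hSx, map_add, hev, hew]
  have hin : inner ℂ (v + w) (symmetry Q (v + w)) = Real.cos r * inner ℂ (v + w) (v + w) := by
    rw [hQx, hxx, inner_add_left, inner_add_right, inner_add_right]
    simp only [inner_smul_right, hvw, hwv, hww]
    rw [Complex.exp_mul_I, Complex.exp_mul_I]
    push_cast
    rw [Complex.cos_neg, Complex.sin_neg]
    ring
  have hunit : ‖((‖v + w‖⁻¹ : ℝ) : ℂ) • (v + w)‖ = 1 := by
    rw [norm_smul, Complex.norm_real, norm_inv, norm_norm,
      inv_mul_cancel₀ (norm_ne_zero_iff.2 hne)]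
  refine ⟨((‖v + w‖⁻¹ : ℝ) : ℂ) • (v + w), hunit, by rw [map_smul, hPx], ?_⟩
  set x := ((‖v + w‖⁻¹ : ℝ) : ℂ) • (v + w) with hx
  have hinx : inner ℂ x (symmetry Q x) = Real.cos r := by
    have h1 : inner ℂ x (symmetry Q x) = Real.cos r * inner ℂ x x := by
      rw [hx, map_smul, inner_smul_left, inner_smul_right, inner_smul_left, inner_smul_right, hin]
      ring
    rw [h1, inner_self_eq_norm_sq_to_K, hunit]
    simp
  have hsym : inner ℂ x (symmetry Q x) = 2 * inner ℂ x (Q x) - 1 := by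
    have h1 : symmetry Q x = Q x + Q x - x := rfl
    rw [h1, inner_sub_right, inner_add_right, inner_self_eq_norm_sq_to_K x, hunit]
    norm_num
    ring
  rw [hsym] at hinx
  have := congrArg Complex.re hinx
  rw [Complex.ofReal_re] at this
  rw [cosDoubleAngle, ← hr, Real.cos_abs, ← this]
  simp

theorem norm_generator_le_length {P Q Y : H →L[ℂ] H} (hP : P ∈ projections H)
    (hY : IsSelfAdjoint Y) (hYc : IsCompactOperator Y)
    (hYP : symmetry P * Y = -(Y * symmetry P)) (hYn : ‖Y‖ ≤ Real.pi)
    (hQ : NormedSpace.exp (Complex.I • Y) * symmetry P = symmetry Q)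
    {γ : ℝ → (H →L[ℂ] H)} (h : IsPiecewiseC1 γ)
    (hγ : ∀ t ∈ Icc (0 : ℝ) 1, γ t ∈ projections H) (h0 : γ 0 = P) (h1 : γ 1 = Q) :
    ‖Y‖ / 2 ≤ ∫ t in (0 : ℝ)..1, ‖deriv γ t‖ := by
  by_cases hY0 : Y = 0
  · rw [hY0, norm_zero, zero_div]
    exact intervalIntegral.integral_nonneg zero_le_one fun t _ => norm_nonneg _
  obtain ⟨x, hx, hPx, hxQ⟩ := exists_cosDoubleAngle_eq_cos_norm hP hY hYc hYP hQ hY0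
  have := h.arccos_le_length hγ hx (by rw [h0, hPx])
  rw [h1, hxQ, Real.arccos_cos (norm_nonneg _) hYn] at this
  linarith

/-- Pairing the two speeds `f`, `g` with `(a, b)` gives `a f + b g ≤ C √(f² + g²)` pointwise, where
`C = √(a² + b²)`. Integrating gives `C² ≤ C · curveLength γ`. -/
theorem sqrt_le_curveLength {γ : ℝ → (H →L[ℂ] H) × (H →L[ℂ] H)} (h : IsPiecewiseC1 γ) {a b : ℝ}
    (ha : 0 ≤ a) (hb : 0 ≤ b) (hla : a ≤ ∫ t in (0 : ℝ)..1, ‖deriv (fun s => (γ s).1) t‖)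
    (hlb : b ≤ ∫ t in (0 : ℝ)..1, ‖deriv (fun s => (γ s).2) t‖) :
    √(a ^ 2 + b ^ 2) ≤ curveLength γ := by
  have h1 : IsPiecewiseC1 fun t => (γ t).1 := h.comp_clm (ContinuousLinearMap.fst ℝ _ _)
  have h2 : IsPiecewiseC1 fun t => (γ t).2 := h.comp_clm (ContinuousLinearMap.snd ℝ _ _)
  have i1 := h1.intervalIntegrable
  have i2 := h2.intervalIntegrable
  set f := fun t => ‖deriv (fun s => (γ s).1) t‖
  set g := fun t => ‖deriv (fun s => (γ s).2) t‖
  have hf (t : ℝ) : 0 ≤ f t := norm_nonneg _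
  have hg (t : ℝ) : 0 ≤ g t := norm_nonneg _
  have i3 : IntervalIntegrable (fun t => √(f t ^ 2 + g t ^ 2)) MeasureTheory.volume 0 1 := by
    refine (i1.add i2).mono_fun ?_ ?_
    · have m1 := i1.aestronglyMeasurable_restrict_uIoc
      have m2 := i2.aestronglyMeasurable_restrict_uIoc
      exact Real.continuous_sqrt.comp_aestronglyMeasurable ((m1.pow 2).add (m2.pow 2))
    · refine Filter.Eventually.of_forall fun t => ?_
      change ‖√(f t ^ 2 + g t ^ 2)‖ ≤ ‖f t + g t‖
      rw [Real.norm_of_nonneg (Real.sqrt_nonneg _),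
        Real.norm_of_nonneg (add_nonneg (hf t) (hg t))]
      rw [Real.sqrt_le_left (add_nonneg (hf t) (hg t))]
      nlinarith [mul_nonneg (hf t) (hg t)]
  set C := √(a ^ 2 + b ^ 2)
  have hC : 0 ≤ C := Real.sqrt_nonneg _
  have hCsq : C ^ 2 = a ^ 2 + b ^ 2 := Real.sq_sqrt (by positivity)
  have hle : ∫ t in (0 : ℝ)..1, (a * f t + b * g t) ≤
      ∫ t in (0 : ℝ)..1, C * √(f t ^ 2 + g t ^ 2) := by
    refine intervalIntegral.integral_mono_on zero_le_one
      ((i1.const_mul a).add (i2.const_mul b)) (i3.const_mul C) fun t _ => ?_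
    rw [← Real.sqrt_mul (by positivity)]
    refine Real.le_sqrt_of_sq_le ?_
    nlinarith [sq_nonneg (a * g t - b * f t)]
  rw [intervalIntegral.integral_add (i1.const_mul a) (i2.const_mul b),
    intervalIntegral.integral_const_mul, intervalIntegral.integral_const_mul,
    intervalIntegral.integral_const_mul] at hle
  change C ≤ ∫ t in (0 : ℝ)..1, √(f t ^ 2 + g t ^ 2)
  by_cases hC0 : C = 0
  · rw [hC0]
    exact intervalIntegral.integral_nonneg zero_le_one fun t _ => Real.sqrt_nonneg _
  have hCpos : 0 < C := lt_of_le_of_ne hC (Ne.symm hC0)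
  nlinarith [mul_le_mul_of_nonneg_left hla ha, mul_le_mul_of_nonneg_left hlb hb]

theorem curveLength_geodesicOf_le {P₁ P₂ Y₁ Y₂ : H →L[ℂ] H} (hP₁ : P₁ ∈ projections H)
    (hP₂ : P₂ ∈ projections H) (hY₁ : IsSelfAdjoint Y₁) (hY₂ : IsSelfAdjoint Y₂)
    (hYP₁ : symmetry P₁ * Y₁ = -(Y₁ * symmetry P₁))
    (hYP₂ : symmetry P₂ * Y₂ = -(Y₂ * symmetry P₂)) :
    curveLength (fun t => (geodesicOf P₁ Y₁ t, geodesicOf P₂ Y₂ t)) ≤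
      √((‖Y₁‖ / 2) ^ 2 + (‖Y₂‖ / 2) ^ 2) := by
  have h := intervalIntegral.norm_integral_le_of_norm_le_const (a := 0) (b := 1)
    (C := √((‖Y₁‖ / 2) ^ 2 + (‖Y₂‖ / 2) ^ 2))
    (f := fun t => √(‖deriv (geodesicOf P₁ Y₁) t‖ ^ 2 + ‖deriv (geodesicOf P₂ Y₂) t‖ ^ 2))
    (fun t _ => by
      rw [Real.norm_of_nonneg (Real.sqrt_nonneg _)]
      have := norm_deriv_geodesicOf_le hP₁ hY₁ hYP₁ t
      have := norm_deriv_geodesicOf_le hP₂ hY₂ hYP₂ t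
      gcongr)
  rw [sub_zero, abs_one, mul_one] at h
  exact (le_abs_self _).trans h

/-! ### The restricted Grassmannian -/

/-- The cocycle identity based at `R` reads `j = k + pairIndex P Q`. -/
theorem pairIndex_eq_zero_of_mem_grResComp {R P Q : H →L[ℂ] H} (hR : R ∈ projections H) {k j : ℤ}
    (hP : P ∈ GrResComp R k) (hQ : Q ∈ GrResComp R j) :
    IsCompactOperator (P - Q) ∧ (pairIndex P Q = 0 ↔ k = j) := by
  obtain ⟨⟨hPp, hPc⟩, hPk⟩ := hP
  obtain ⟨⟨hQp, hQc⟩, hQj⟩ := hQ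
  have hc : IsCompactOperator (P - Q) := by
    have := hPc.sub hQc
    rwa [← FunLike.coe_sub, sub_sub_sub_cancel_right] at this
  have := pairIndex_cocycle hR hPp hQp (isCompactOperator_sub_comm hPc)
    (isCompactOperator_sub_comm hQc)
  refine ⟨hc, ?_⟩
  constructor <;> intro h <;> lia

theorem exists_generator_of_mem_grResComp {R P Q : H →L[ℂ] H} (hR : R ∈ projections H) {k : ℤ}
    (hP : P ∈ GrResComp R k) (hQ : Q ∈ GrResComp R k) :
    ∃ Y : H →L[ℂ] H, IsSelfAdjoint Y ∧ IsCompactOperator Y ∧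
      symmetry P * Y = -(Y * symmetry P) ∧ ‖Y‖ ≤ Real.pi ∧
      NormedSpace.exp (Complex.I • Y) * symmetry P = symmetry Q :=
  have h := pairIndex_eq_zero_of_mem_grResComp hR hP hQ
  exists_generator hP.1.1 hQ.1.1 h.1 (h.2.2 rfl)

/-- No continuity of the index is needed: each point of the curve has a common complement with `P`
and a compact difference from it, which forces relative index zero. -/
theorem geodesicOf_mem_grResComp {R P Y : H →L[ℂ] H} (hR : R ∈ projections H) {k : ℤ}
    (hP : P ∈ GrResComp R k) (hY : IsSelfAdjoint Y) (hYc : IsCompactOperator Y)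
    (hYP : symmetry P * Y = -(Y * symmetry P)) (hYn : ‖Y‖ ≤ Real.pi) {t : ℝ}
    (ht : t ∈ Icc (0 : ℝ) 1) : geodesicOf P Y t ∈ GrResComp R k := by
  have hc := isCompactOperator_geodesicOf_sub (P := P) hYc t
  have hp := geodesicOf_mem_projections hP.1.1 hY hYP t
  have hg : geodesicOf P Y t ∈ GrRes R := by
    refine ⟨hp, ?_⟩
    have := hc.add hP.1.2
    rwa [← FunLike.coe_add, sub_add_sub_cancel] at this
  have h0 := pairIndex_eq_zero_of_haveCommonComplement hP.1.1 hp (isCompactOperator_sub_comm hc)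
    (haveCommonComplement_geodesicOf hP.1.1 hY hYP hYn ht)
  have := (pairIndex_eq_zero_of_mem_grResComp hR hP ⟨hg, rfl⟩).2.1 h0
  exact ⟨hg, this.symm⟩

theorem joinedByMinimizingGeodesicIn_grResComp {R : H →L[ℂ] H} (hR : R ∈ projections H) {k j : ℤ}
    {a b : (H →L[ℂ] H) × (H →L[ℂ] H)} (ha : a ∈ GrResComp R k ×ˢ GrResComp R j)
    (hb : b ∈ GrResComp R k ×ˢ GrResComp R j) :
    JoinedByMinimizingGeodesicIn (GrResComp R k ×ˢ GrResComp R j) a b := by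
  obtain ⟨Y₁, s₁, c₁, a₁, n₁, e₁⟩ := exists_generator_of_mem_grResComp hR ha.1 hb.1
  obtain ⟨Y₂, s₂, c₂, a₂, n₂, e₂⟩ := exists_generator_of_mem_grResComp hR ha.2 hb.2
  have hp₁ := ha.1.1.1
  have hp₂ := ha.2.1.1
  have hδ0 : (geodesicOf a.1 Y₁ 0, geodesicOf a.2 Y₂ 0) = a := by
    rw [geodesicOf_zero, geodesicOf_zero]
  have hδ1 : (geodesicOf a.1 Y₁ 1, geodesicOf a.2 Y₂ 1) = b := by
    rw [geodesicOf_one e₁, geodesicOf_one e₂]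
  refine ⟨fun t => (geodesicOf a.1 Y₁ t, geodesicOf a.2 Y₂ t),
    ⟨isGeodesic_geodesicOf hp₁ s₁ a₁, isGeodesic_geodesicOf hp₂ s₂ a₂, ?_⟩, hδ0, hδ1, fun t ht =>
    ⟨geodesicOf_mem_grResComp hR ha.1 s₁ c₁ a₁ n₁ ht,
      geodesicOf_mem_grResComp hR ha.2 s₂ c₂ a₂ n₂ ht⟩⟩
  intro γ hγ hγP h0 h1
  replace h0 : γ 0 = a := h0.trans hδ0
  replace h1 : γ 1 = b := h1.trans hδ1
  refine (curveLength_geodesicOf_le hp₁ hp₂ s₁ s₂ a₁ a₂).trans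
    (sqrt_le_curveLength hγ (by positivity) (by positivity) ?_ ?_)
  · exact norm_generator_le_length hp₁ s₁ c₁ a₁ n₁ e₁ (hγ.comp_clm (ContinuousLinearMap.fst ℝ _ _))
      (fun t ht => (hγP t ht).1) (congrArg Prod.fst h0) (congrArg Prod.fst h1)
  · exact norm_generator_le_length hp₂ s₂ c₂ a₂ n₂ e₂ (hγ.comp_clm (ContinuousLinearMap.snd ℝ _ _))
      (fun t ht => (hγP t ht).2) (congrArg Prod.snd h0) (congrArg Prod.snd h1)

theorem JoinedByMinimizingGeodesicIn.mono {A B : Set ((H →L[ℂ] H) × (H →L[ℂ] H))} (hAB : A ⊆ B)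
    {a b : (H →L[ℂ] H) × (H →L[ℂ] H)} (h : JoinedByMinimizingGeodesicIn A a b) :
    JoinedByMinimizingGeodesicIn B a b :=
  let ⟨δ, hδ, h0, h1, hA⟩ := h
  ⟨δ, hδ, h0, h1, fun t ht => hAB (hA t ht)⟩

theorem grResComp_prod_subset_delta {R : H →L[ℂ] H} (hR : R ∈ projections H) (k : ℤ) :
    GrResComp R k ×ˢ GrResComp R k ⊆ Delta H := by
  rintro ⟨P, Q⟩ ⟨hP, hQ⟩
  obtain ⟨Y, s, c, a, n, e⟩ := exists_generator_of_mem_grResComp hR hP hQ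
  refine ⟨hP.1.1, hQ.1.1, ?_⟩
  have := haveCommonComplement_geodesicOf hP.1.1 s a n (right_mem_Icc.2 zero_le_one)
  rwa [geodesicOf_one e] at this

theorem grResComp_prod_subset_gamma {R : H →L[ℂ] H} (hR : R ∈ projections H) {k j : ℤ}
    (hkj : k ≠ j) : GrResComp R k ×ˢ GrResComp R j ⊆ Gamma H := by
  rintro ⟨P, Q⟩ ⟨hP, hQ⟩
  refine ⟨hP.1.1, hQ.1.1, fun hc => hkj ?_⟩
  obtain ⟨h1, h2⟩ := pairIndex_eq_zero_of_mem_grResComp hR hP hQ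
  exact h2.1 (pairIndex_eq_zero_of_haveCommonComplement hP.1.1 hQ.1.1 h1 hc)

end

end CommonComplement

end

theorem mainTheorem9 {H : Type*} [NormedAddCommGroup H] [InnerProductSpace ℂ H] [CompleteSpace H]
    [TopologicalSpace.SeparableSpace H] (Pplus : H →L[ℂ] H)
    (hPplus : Pplus ∈ CommonComplement.projections H)
    (hrange : ¬ FiniteDimensional ℂ Pplus.range) (hker : ¬ FiniteDimensional ℂ Pplus.ker) :
    (∀ k : ℤ,
      CommonComplement.GrResComp Pplus k ×ˢ CommonComplement.GrResComp Pplus k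
          ⊆ CommonComplement.Delta H ∧
        ∀ a ∈ CommonComplement.GrResComp Pplus k ×ˢ CommonComplement.GrResComp Pplus k,
        ∀ b ∈ CommonComplement.GrResComp Pplus k ×ˢ CommonComplement.GrResComp Pplus k,
          CommonComplement.JoinedByMinimizingGeodesicIn (CommonComplement.Delta H) a b) ∧
    (∀ k j : ℤ, k ≠ j →
      CommonComplement.GrResComp Pplus k ×ˢ CommonComplement.GrResComp Pplus j
          ⊆ CommonComplement.Gamma H ∧
        ∀ a ∈ CommonComplement.GrResComp Pplus k ×ˢ CommonComplement.GrResComp Pplus j,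
        ∀ b ∈ CommonComplement.GrResComp Pplus k ×ˢ CommonComplement.GrResComp Pplus j,
          CommonComplement.JoinedByMinimizingGeodesicIn (CommonComplement.Gamma H) a b) := by
  refine ⟨fun k => ⟨CommonComplement.grResComp_prod_subset_delta hPplus k, fun a ha b hb => ?_⟩,
    fun k j hkj => ⟨CommonComplement.grResComp_prod_subset_gamma hPplus hkj, fun a ha b hb => ?_⟩⟩
  · exact (CommonComplement.joinedByMinimizingGeodesicIn_grResComp hPplus ha hb).mono
      (CommonComplement.grResComp_prod_subset_delta hPplus k)
  · exact (CommonComplement.joinedByMinimizingGeodesicIn_grResComp hPplus ha hb).mono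
      (CommonComplement.grResComp_prod_subset_gamma hPplus hkj)
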